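/- Let $2\le s<n<N$ be integers. Consider $n$ distinct blocks, a store with $N$ positions each of which holds one block, and an obfuscation client (OC) whose buffer holds a set $U$ of $s$ distinct blocks. Let $V$ be the set of the $n-s$ blocks that are not in $U$. The OC processes one position per round: independently and uniformly at random, a position $p$ of the store, a block $B\in U$ and a block $B'\in V$ are chosen; position $p$ is overwritten with $B$, and $B'$ takes the place of $B$ in the buffer. The adversary knows the initial store and buffer contents (which are arbitrary) and observes the access pattern, i.e. the sequence of processed positions, but not the choices of $B$ and $B'$. Say that a randomized stopping time $T$ of the sequence of rounds (stopping may depend on the choices made so far and on independent randomness) achieves perfect privacy if $T<\infty$ almost surely and, conditionally on every value of $T$ and of the access pattern up to round $T$ that occurs with positive probability, the distribution of the buffer and store contents after round $T$ is invariant under all permutations of the $n$ block names (so the adversary has no knowledge of which block is in which place; in particular, every position holds each of the $n$ blocks with probability $1/n$). Then perfect privacy needs at most $$2+s+(n-s)\log_2(n-s)+N\log_2 N$$ rounds of the OC in expectation: for every initial contents of the store and the buffer there is a stopping time $T$ that achieves perfect privacy and has $\mathbb E[T]\le 2+s+(n-s)\log_2(n-s)+N\log_2 N$. -/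

import Mathlib

open scoped ENNReal

namespace CAOS

/-- The contents of the system with `n` block ids and `N` store positions: the set of block ids held
in the buffer of the obfuscation client (OC), and the block id held at each store position. -/
structure Layout (n N : ℕ) where
  buffer : Finset (Fin n)
  store : Fin N → Fin n

/-- Renaming the blocks of a layout. -/
def Layout.relabel {n N : ℕ} (π : Equiv.Perm (Fin n)) (L : Layout n N) : Layout n N where
  buffer := L.buffer.map π.toEmbedding
  store := fun p => π (L.store p)

/-- The random choices of one OC round: the store position that is processed, the block that is
evicted from the buffer, and the block that enters the buffer. -/
structure Round (n N : ℕ) where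
  pos : Fin N
  evicted : Fin n
  admitted : Fin n

/-- The effect of a round: the evicted block overwrites the processed position, and the admitted
block takes the vacated place in the buffer. -/
def Layout.step {n N : ℕ} (L : Layout n N) (c : Round n N) : Layout n N where
  buffer := insert c.admitted (L.buffer.erase c.evicted)
  store := Function.update L.store c.pos c.evicted

/-- The probability of the choices `c` in a round started from `L`: the position is uniform among
the `N` positions, the evicted block is uniform in the buffer, and the admitted block is uniform
among the blocks outside the buffer, the three choices being independent. -/
noncomputable def Layout.roundProb {n N : ℕ} (L : Layout n N) (c : Round n N) : ℝ≥0∞ :=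
  if c.evicted ∈ L.buffer ∧ c.admitted ∉ L.buffer then
    (N : ℝ≥0∞)⁻¹ * (L.buffer.card : ℝ≥0∞)⁻¹ * (L.bufferᶜ.card : ℝ≥0∞)⁻¹
  else 0

/-- A finite history of rounds, the most recent round first. -/
abbrev History (n N : ℕ) := List (Round n N)

/-- The layout reached from `L₀` through the history `h`. -/
def layoutAfter {n N : ℕ} (L₀ : Layout n N) : History n N → Layout n N
  | [] => L₀
  | c :: h => (layoutAfter L₀ h).step c

/-- The probability that the first `h.length` rounds, started from `L₀`, are those of `h`. -/
noncomputable def historyProb {n N : ℕ} (L₀ : Layout n N) : History n N → ℝ≥0∞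
  | [] => 1
  | c :: h => historyProb L₀ h * (layoutAfter L₀ h).roundProb c

/-- What the adversary observes of a history: the access pattern, that is, the sequence of
processed positions (the most recent first). -/
def accessPattern {n N : ℕ} (h : History n N) : List (Fin N) :=
  h.map Round.pos

/-- A randomized stopping time `T` for the rounds: `prob h` is the conditional probability of
`T = h.length`, given that the first `h.length` rounds are those of `h`. It depends on these rounds
only, not on later ones. Along each run the events `T = 0, T = 1, …` are disjoint; the initial
segments of `h` are the tails of the list. -/
structure StoppingTime (n N : ℕ) where
  prob : History n N → ℝ≥0∞
  sum_tails_le_one : ∀ h : History n N, (h.tails.map prob).sum ≤ 1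

namespace StoppingTime

variable {n N : ℕ}

/-- The probability that `T = h.length` and that the rounds up to time `T` are those of `h`. -/
noncomputable def stopProb (T : StoppingTime n N) (L₀ : Layout n N) (h : History n N) : ℝ≥0∞ :=
  historyProb L₀ h * T.prob h

/-- `T` is finite with probability one. -/
def IsFinite (T : StoppingTime n N) (L₀ : Layout n N) : Prop :=
  ∑' h : History n N, T.stopProb L₀ h = 1

/-- The expected number of rounds `𝔼[T]` (for an almost surely finite `T`). -/
noncomputable def expectedRounds (T : StoppingTime n N) (L₀ : Layout n N) : ℝ≥0∞ :=
  ∑' h : History n N, (h.length : ℝ≥0∞) * T.stopProb L₀ h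

/-- The joint probability that `T = w.length`, that the access pattern up to time `T` is `w`, and
that the layout at time `T` is `L`. Divided by the probability of `T = w.length` and `w`, this is
the posterior distribution of the layout for an adversary that knows the initial layout `L₀` and
observes `T` and the access pattern. -/
noncomputable def jointProb (T : StoppingTime n N) (L₀ : Layout n N) (w : List (Fin N))
    (L : Layout n N) : ℝ≥0∞ :=
  ∑' h : {h : History n N // accessPattern h = w ∧ layoutAfter L₀ h = L}, T.stopProb L₀ h

/-- `T` is almost surely finite, and at time `T` there is perfect privacy: the adversary has no
knowledge of which block is where. That is, whatever the value of `T` and the access pattern are,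
all renamings of the blocks of a layout (buffer and store) are equally likely a posteriori. As the
rounds treat all blocks alike, this then persists in all later rounds. -/
def AchievesPerfectPrivacy (T : StoppingTime n N) (L₀ : Layout n N) : Prop :=
  T.IsFinite L₀ ∧ ∀ (w : List (Fin N)) (L : Layout n N) (π : Equiv.Perm (Fin n)),
    T.jointProb L₀ w (L.relabel π) = T.jointProb L₀ w L

end StoppingTime

end CAOS

/-! The stopping time has two phases. In the first, the buffer performs a Bernoulli–Laplace exchange
chain, which is independent of the processed positions. A randomized rule marks the buffer as mixed
in such a way that, given the marking time and the access pattern, it is uniform among the sets of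
`s` blocks. In the second, one waits until every position has been processed since the marking. Each
round keeps the joint law of the buffer and the freshly written positions invariant under renaming,
so at the end the whole layout is invariant. The second phase is a coupon collection and costs at
most `N * H_N ≤ 1 + N log₂ N`, with `H_k` the harmonic sum.

The marking rule comes from strong stationary duality (`exists_bufferFlow_of_dual`). The law of the
buffer is written as a mixture of explicit densities, among which one round acts as a nonnegative
kernel that leaks into the uniform density; the leaked part is what gets marked. The densities
describe a buffer lying inside the union of the initial buffer and a random set of `k` other blocks,
or having exactly one block outside that union. With `M = min s (n - s)`, a potential bounds the
expected absorption time by `1 + M + M * H_(M-1)` (`exists_bufferFlow`), at most `1 + s + (n - s)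
log₂ (n - s)`. The case `n - s = 1`, where a coefficient of this kernel is negative, has its own
two-state dual.

The argument runs on unnormalized masses instead of random variables: a flow of surviving and
stopped mass that obeys the one-round evolution is realized by a stopping time
(`exists_stoppingTime_of_flow`), and privacy and expectation are read off from the flow
(`exists_perfectPrivacy_of_bufferFlow`). -/

namespace CAOS

variable {n N : ℕ}

/-! ### Stopping times from flows of mass -/

/-- The mass carried from `F` to a layout by a round that processes position `p`. -/
noncomputable def stepMass (p : Fin N) (F : Layout n N → ℝ≥0∞) (L' : Layout n N) : ℝ≥0∞ :=
  open Classical in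
  ∑' (L : Layout n N) (c : Round n N),
    if c.pos = p ∧ L.step c = L' then F L * L.roundProb c else 0

theorem tsum_list {X : Type*} (f : List X → ℝ≥0∞) :
    ∑' l, f l = f [] + ∑' (x : X) (l : List X), f (x :: l) := by
  let e : Unit ⊕ (X × List X) ≃ List X :=
    { toFun := Sum.elim (fun _ => []) fun q => q.1 :: q.2
      invFun := fun l => match l with
        | [] => Sum.inl ()
        | x :: l => Sum.inr (x, l)
      left_inv := by rintro (_ | ⟨x, l⟩) <;> rfl
      right_inv := by rintro (_ | ⟨x, l⟩) <;> rfl }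
  rw [← e.tsum_eq f, Summable.tsum_sum (f := fun c => f (e c)) ENNReal.summable ENNReal.summable,
    ENNReal.tsum_prod']
  simp [e]

/-- The hazard rate of the flow with surviving mass `α` and stopped mass `γ`, at the end of the
history `h`. -/
noncomputable def hazard (L₀ : Layout n N) (α γ : List (Fin N) → Layout n N → ℝ≥0∞)
    (h : History n N) : ℝ≥0∞ :=
  γ (accessPattern h) (layoutAfter L₀ h) /
    (α (accessPattern h) (layoutAfter L₀ h) + γ (accessPattern h) (layoutAfter L₀ h))

theorem hazard_le_one (L₀ : Layout n N) (α γ : List (Fin N) → Layout n N → ℝ≥0∞)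
    (h : History n N) : hazard L₀ α γ h ≤ 1 :=
  ENNReal.div_le_of_le_mul (by simp)

/-- The probability of not having stopped strictly before the end of a history. -/
noncomputable def survival (r : History n N → ℝ≥0∞) : History n N → ℝ≥0∞
  | [] => 1
  | _ :: h => survival r h * (1 - r h)

/-- Along a run, the stopping probabilities telescope; what is missing from 1 is the probability of
continuing past the end of `h`. -/
theorem sum_tails_survival (r : History n N → ℝ≥0∞) (hr : ∀ h, r h ≤ 1) (h : History n N) :
    (h.tails.map fun g => survival r g * r g).sum + survival r h * (1 - r h) = 1 := by
  have key : ∀ g : History n N, survival r g * r g + survival r g * (1 - r g) = survival r g := by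
    intro g
    rw [← mul_add, add_tsub_cancel_of_le (hr g), mul_one]
  induction h with
  | nil => simpa [survival] using key []
  | cons c h ih =>
    rw [List.tails_cons, List.map_cons, List.sum_cons, add_right_comm, key, add_comm]
    exact ih

/-- The stopping time with hazard rate `r`. -/
noncomputable def StoppingTime.ofHazard (r : History n N → ℝ≥0∞) (hr : ∀ h, r h ≤ 1) :
    StoppingTime n N where
  prob h := survival r h * r h
  sum_tails_le_one h := (sum_tails_survival r hr h).le.trans' le_self_add

open Classical in
theorem StoppingTime.jointProb_eq_tsum_ite (T : StoppingTime n N) (L₀ : Layout n N)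
    (w : List (Fin N)) (L : Layout n N) :
    T.jointProb L₀ w L =
      ∑' h, if accessPattern h = w ∧ layoutAfter L₀ h = L then T.stopProb L₀ h else 0 := by
  rw [StoppingTime.jointProb]
  refine (tsum_subtype {h : History n N | accessPattern h = w ∧ layoutAfter L₀ h = L}
    (fun h => T.stopProb L₀ h)).trans ?_
  refine tsum_congr fun h => ?_
  simp [Set.indicator_apply]

section Flow

variable (L₀ : Layout n N) (α γ : List (Fin N) → Layout n N → ℝ≥0∞)

-- The hazard depends on a history only through its access pattern and final layout. All histories
-- with the same pattern and layout are therefore thinned by the same factor, and induction over the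
-- pattern shows that the mass reaching this point before a stopping decision is the prescribed one.
open Classical in
theorem tsum_survival_eq (hfin : ∀ w L, α w L + γ w L ≠ ∞)
    (h0 : ∀ L, α [] L + γ [] L = if L = L₀ then 1 else 0)
    (hs : ∀ p w L, α (p :: w) L + γ (p :: w) L = stepMass p (α w) L)
    (w : List (Fin N)) (L : Layout n N) :
    ∑' h, (if accessPattern h = w ∧ layoutAfter L₀ h = L then
      historyProb L₀ h * survival (hazard L₀ α γ) h else 0) = α w L + γ w L := by
  induction w generalizing L with
  | nil =>
    rw [tsum_list, h0]
    have e1 : ∀ (c : Round n N) (h : History n N), (if accessPattern (c :: h) = [] ∧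
        layoutAfter L₀ (c :: h) = L then
        historyProb L₀ (c :: h) * survival (hazard L₀ α γ) (c :: h) else 0) = 0 :=
      fun c h => if_neg (by simp [accessPattern])
    simp_rw [e1, tsum_zero, add_zero]
    rw [historyProb, survival, mul_one]
    exact if_congr (by rw [accessPattern, List.map_nil, layoutAfter, eq_comm (a := L)]; simp)
      rfl rfl
  | cons p w ih =>
    have ih' : ∀ L, ∑' h, (if accessPattern h = w ∧ layoutAfter L₀ h = L then
        historyProb L₀ h * (survival (hazard L₀ α γ) h * (1 - hazard L₀ α γ h)) else 0)
          = α w L := by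
      intro L
      -- Where the total mass vanishes the value of the hazard is irrelevant; elsewhere the
      -- proportion that continues is `α / (α + γ)`.
      have hx : 1 - γ w L / (α w L + γ w L) = α w L / (α w L + γ w L) ∨ α w L + γ w L = 0 := by
        by_cases h : α w L + γ w L = 0
        · exact Or.inr h
        left
        have h1 : 1 = α w L / (α w L + γ w L) + γ w L / (α w L + γ w L) := by
          rw [← ENNReal.add_div, ENNReal.div_self h (hfin w L)]
        conv_lhs => rw [h1]
        refine ENNReal.add_sub_cancel_right ?_
        exact (ENNReal.div_le_of_le_mul (by simp) |>.trans_lt ENNReal.one_lt_top).ne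
      have hy : (α w L + γ w L) * (1 - γ w L / (α w L + γ w L)) = α w L := by
        rcases hx with hx | hx
        · by_cases h : α w L + γ w L = 0
          · rw [h, zero_mul]; exact (add_eq_zero.1 h).1.symm
          · rw [hx, ENNReal.mul_div_cancel h (hfin w L)]
        · rw [hx, zero_mul]; exact (add_eq_zero.1 hx).1.symm
      rw [← hy, ← ih, ← ENNReal.tsum_mul_right]
      refine tsum_congr fun h => ?_
      split_ifs with hc
      · rw [hazard, hc.1, hc.2, ← ih, mul_assoc]
      · simp
    rw [hs, stepMass, tsum_list]
    have e0 : (if accessPattern ([] : History n N) = p :: w ∧ layoutAfter L₀ [] = L then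
      historyProb L₀ [] * survival (hazard L₀ α γ) [] else 0) = 0 := by
      simp [accessPattern]
    rw [e0, zero_add]
    have e1 : ∀ (c : Round n N) (h : History n N),
        (if accessPattern (c :: h) = p :: w ∧ layoutAfter L₀ (c :: h) = L then
          historyProb L₀ (c :: h) * survival (hazard L₀ α γ) (c :: h) else 0) =
        ∑' M : Layout n N, (if c.pos = p ∧ M.step c = L then
          (if accessPattern h = w ∧ layoutAfter L₀ h = M then
          historyProb L₀ h * (survival (hazard L₀ α γ) h * (1 - hazard L₀ α γ h)) else 0)
            * M.roundProb c else 0) := by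
      intro c h
      rw [tsum_eq_single (layoutAfter L₀ h)]
      · simp only [accessPattern, List.map_cons, List.cons.injEq, layoutAfter, historyProb,
          survival]
        by_cases h1 : c.pos = p <;> by_cases h2 : List.map Round.pos h = w <;>
          by_cases h3 : (layoutAfter L₀ h).step c = L <;> (simp [h1, h2, h3]; try ring)
      · intro M hM
        simp [hM.symm]
    simp_rw [e1]
    refine (tsum_congr fun c => ENNReal.tsum_comm).trans ?_
    rw [ENNReal.tsum_comm]
    refine tsum_congr fun M => tsum_congr fun c => ?_
    rw [← ih' M]
    split_ifs with hc
    · rw [ENNReal.tsum_mul_right]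
    · simp

theorem exists_stoppingTime_of_flow (hfin : ∀ w L, α w L + γ w L ≠ ∞)
    (h0 : ∀ L, α [] L + γ [] L = open Classical in if L = L₀ then 1 else 0)
    (hs : ∀ p w L, α (p :: w) L + γ (p :: w) L = stepMass p (α w) L) :
    ∃ T : StoppingTime n N, ∀ w L, T.jointProb L₀ w L = γ w L := by
  classical
  refine ⟨StoppingTime.ofHazard (hazard L₀ α γ) (hazard_le_one L₀ α γ), fun w L => ?_⟩
  have hx : (α w L + γ w L) * (γ w L / (α w L + γ w L)) = γ w L := by
    by_cases h : α w L + γ w L = 0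
    · rw [h, zero_mul]; exact (add_eq_zero.1 h).2.symm
    · exact ENNReal.mul_div_cancel h (hfin w L)
  rw [StoppingTime.jointProb_eq_tsum_ite, ← hx,
    ← tsum_survival_eq L₀ α γ hfin (fun L => by convert h0 L) hs, ← ENNReal.tsum_mul_right]
  refine tsum_congr fun h => ?_
  split_ifs with hc
  · rw [StoppingTime.stopProb, StoppingTime.ofHazard]
    simp only
    rw [tsum_survival_eq L₀ α γ hfin (fun L => by convert h0 L) hs, hazard, hc.1, hc.2, mul_assoc]
  · simp

end Flow

/-! ### Mass per number of rounds, and expected stopping times -/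

/-- The sum of `X w` over the access patterns `w` of length `t`. -/
noncomputable def level (X : List (Fin N) → ℝ≥0∞) (t : ℕ) : ℝ≥0∞ :=
  ∑' w, if w.length = t then X w else 0

theorem level_zero (X : List (Fin N) → ℝ≥0∞) : level X 0 = X [] := by
  rw [level, tsum_list]; simp

theorem level_succ (X : List (Fin N) → ℝ≥0∞) (t : ℕ) :
    level X (t + 1) = level (fun w => ∑ p, X (p :: w)) t := by
  rw [level, tsum_list, level]
  simp only [List.length_nil, List.length_cons, add_left_inj]
  rw [ENNReal.tsum_comm]
  simp only [tsum_fintype, (Nat.succ_ne_zero t).symm, if_false, zero_add]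
  refine tsum_congr fun w => ?_
  split_ifs <;> simp

theorem level_add (X Y : List (Fin N) → ℝ≥0∞) (t : ℕ) :
    level (fun w => X w + Y w) t = level X t + level Y t := by
  rw [level, level, level, ← ENNReal.tsum_add]
  exact tsum_congr fun w => by split_ifs <;> simp

theorem level_mul_left (X : List (Fin N) → ℝ≥0∞) (x : ℝ≥0∞) (t : ℕ) :
    level (fun w => x * X w) t = x * level X t := by
  rw [level, level, ← ENNReal.tsum_mul_left]
  exact tsum_congr fun w => by split_ifs <;> simp

theorem level_inv_pow_mul (hN : N ≠ 0) (x : ℕ → ℝ≥0∞) (t : ℕ) :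
    level (fun w : List (Fin N) => ((N : ℝ≥0∞)⁻¹) ^ w.length * x w.length) t = x t := by
  induction t generalizing x with
  | zero => simp [level_zero]
  | succ t ih =>
    rw [level_succ, ← ih (fun t => x (t + 1))]
    congr 1
    ext w
    simp only [List.length_cons, Finset.sum_const, Finset.card_univ, Fintype.card_fin,
      nsmul_eq_mul, pow_succ]
    have : (N : ℝ≥0∞) * (N : ℝ≥0∞)⁻¹ = 1 :=
      ENNReal.mul_inv_cancel (by simpa using hN) (ENNReal.natCast_ne_top N)
    calc _ = ((N : ℝ≥0∞) * (N : ℝ≥0∞)⁻¹) * ((N : ℝ≥0∞)⁻¹ ^ w.length * x (w.length + 1)) := by ring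
      _ = _ := by rw [this, one_mul]

theorem tsum_eq_tsum_level (X : List (Fin N) → ℝ≥0∞) (g : ℕ → ℝ≥0∞) :
    ∑' w, g w.length * X w = ∑' t, g t * level X t := by
  simp_rw [level, ← ENNReal.tsum_mul_left]
  rw [ENNReal.tsum_comm]
  refine tsum_congr fun w => ?_
  rw [tsum_eq_single w.length]
  · simp
  · intro t ht; simp [ht.symm]

theorem StoppingTime.tsum_stopProb (T : StoppingTime n N) (L₀ : Layout n N) (g : ℕ → ℝ≥0∞) :
    ∑' h : History n N, g h.length * T.stopProb L₀ h =
      ∑' t, g t * level (fun w => ∑' L, T.jointProb L₀ w L) t := by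
  classical
  rw [← tsum_eq_tsum_level]
  simp_rw [T.jointProb_eq_tsum_ite, ← ENNReal.tsum_mul_left]
  rw [tsum_congr fun w => ENNReal.tsum_comm (α := Layout n N) (β := History n N), ENNReal.tsum_comm]
  refine tsum_congr fun h => ?_
  rw [tsum_eq_single (accessPattern h), tsum_eq_single (layoutAfter L₀ h)]
  · simp [accessPattern]
  · intro L hL; simp [hL.symm]
  · intro w hw; simp [hw.symm]

/-- Summability forces the surviving mass `A t` to tend to 0, so all of the conserved total mass 1
is eventually stopped. -/
theorem tsum_stopped_eq_one {A Γ : ℕ → ℝ≥0∞} (h0 : A 0 + Γ 0 = 1)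
    (hs : ∀ t, A (t + 1) + Γ (t + 1) = A t) (hA : ∑' t, A t ≠ ∞) : ∑' t, Γ t = 1 := by
  have hsum : ∀ t, ∑ i ∈ Finset.range (t + 1), Γ i + A t = 1 := by
    intro t
    induction t with
    | zero => simpa [add_comm] using h0
    | succ t ih => rw [Finset.sum_range_succ, add_assoc, add_comm (Γ _), hs, ih]
  have h1 := (ENNReal.tendsto_nat_tsum Γ).comp (Filter.tendsto_add_atTop_nat 1)
  have h2 := ENNReal.tendsto_atTop_zero_of_tsum_ne_top hA
  have h3 := h1.add h2
  simp only [Function.comp_apply, hsum, add_zero] at h3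
  exact (tendsto_nhds_unique h3 tendsto_const_nhds)

/-- The tail-sum formula for expectations: the mass stopped after time `r` is at most the mass
surviving at `r`. -/
theorem tsum_mul_stopped_le {A Γ : ℕ → ℝ≥0∞}
    (hs : ∀ t, A (t + 1) + Γ (t + 1) = A t) : ∑' t : ℕ, (t : ℝ≥0∞) * Γ t ≤ ∑' t, A t := by
  have hsum : ∀ r t, ∑ i ∈ Finset.range t, Γ (r + 1 + i) + A (r + t) = A r := by
    intro r t
    induction t with
    | zero => simp
    | succ t ih =>
      rw [Finset.sum_range_succ, add_assoc, ← ih, add_comm (Γ _), ← hs (r + t)]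
      congr 3; omega
  have h1 : ∀ r : ℕ, ∑' t : ℕ, (if r < t then Γ t else 0) ≤ A r := by
    intro r
    have : ∑' t : ℕ, (if r < t then Γ t else 0) = ∑' i, Γ (r + 1 + i) := by
      have h := Summable.sum_add_tsum_nat_add' (f := fun t : ℕ => if r < t then Γ t else 0)
        (k := r + 1) ENNReal.summable
      rw [← h, Finset.sum_eq_zero, zero_add]
      · refine tsum_congr fun i => ?_
        rw [if_pos (by omega), add_comm]
      · intro i hi
        have := Finset.mem_range.1 hi
        exact if_neg (by omega)
    rw [this]
    refine ENNReal.tsum_le_of_sum_range_le fun t => ?_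
    rw [← hsum r t]
    exact le_self_add
  calc ∑' t : ℕ, (t : ℝ≥0∞) * Γ t = ∑' t : ℕ, ∑' r : ℕ, (if r < t then Γ t else 0) := by
        refine tsum_congr fun t => ?_
        rw [tsum_eq_sum (s := Finset.range t)]
        · rw [Finset.sum_congr rfl fun r hr => if_pos (Finset.mem_range.1 hr)]
          simp
        · intro r hr
          rw [if_neg (by simpa using hr)]
    _ = ∑' r : ℕ, ∑' t : ℕ, (if r < t then Γ t else 0) := ENNReal.tsum_comm
    _ ≤ _ := ENNReal.tsum_le_tsum h1


/-! ### One round acting on masses and on test functions -/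

/-- The expected value of `φ` after a round, started from `L`, on the event that it processes
position `p`. -/
noncomputable def stepMean (p : Fin N) (φ : Layout n N → ℝ≥0∞) (L : Layout n N) : ℝ≥0∞ :=
  (N : ℝ≥0∞)⁻¹ * (L.buffer.card : ℝ≥0∞)⁻¹ * (L.bufferᶜ.card : ℝ≥0∞)⁻¹ *
    ∑ i ∈ L.buffer, ∑ j ∈ L.bufferᶜ, φ (L.step ⟨p, i, j⟩)

/-- A round as a triple. -/
def roundEquiv : Round n N ≃ Fin N × Fin n × Fin n where
  toFun c := (c.pos, c.evicted, c.admitted)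
  invFun q := ⟨q.1, q.2.1, q.2.2⟩
  left_inv _ := rfl
  right_inv _ := rfl

theorem tsum_round_eq_stepMean (p : Fin N) (φ : Layout n N → ℝ≥0∞) (L : Layout n N) :
    ∑' c : Round n N, (if c.pos = p then L.roundProb c * φ (L.step c) else 0) =
      stepMean p φ L := by
  rw [← roundEquiv.symm.tsum_eq, ENNReal.tsum_prod', tsum_eq_single p]
  · simp only [roundEquiv, Equiv.coe_fn_symm_mk, if_true]
    rw [ENNReal.tsum_prod']
    simp only [tsum_fintype, Layout.roundProb, stepMean]
    rw [Finset.mul_sum, ← Finset.sum_subset (Finset.subset_univ L.buffer)]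
    · refine Finset.sum_congr rfl fun i hi => ?_
      rw [Finset.mul_sum, ← Finset.sum_subset (Finset.subset_univ L.bufferᶜ)]
      · refine Finset.sum_congr rfl fun j hj => ?_
        rw [if_pos ⟨hi, Finset.mem_compl.1 hj⟩]
      · intro j _ hj
        rw [Finset.mem_compl, not_not] at hj
        simp [hj]
    · intro i _ hi
      simp [hi]
  · intro q hq
    simp [roundEquiv, hq]

/-- Pushing masses forward is adjoint to averaging test functions; later facts about `stepMass` are
proved by testing through this identity. -/
theorem tsum_stepMass_mul (p : Fin N) (F φ : Layout n N → ℝ≥0∞) :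
    ∑' L, stepMass p F L * φ L = ∑' L, F L * stepMean p φ L := by
  classical
  simp_rw [stepMass, ← ENNReal.tsum_mul_right]
  rw [ENNReal.tsum_comm]
  refine tsum_congr fun L => ?_
  rw [ENNReal.tsum_comm, ← tsum_round_eq_stepMean, ← ENNReal.tsum_mul_left]
  refine tsum_congr fun c => ?_
  rw [tsum_eq_single (L.step c)]
  · by_cases h : c.pos = p <;> simp [h, mul_assoc]
  · intro M hM
    simp [hM.symm]

theorem stepMass_add (p : Fin N) (F G : Layout n N → ℝ≥0∞) (L : Layout n N) :
    stepMass p (fun L => F L + G L) L = stepMass p F L + stepMass p G L := by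
  classical
  simp_rw [stepMass, ← ENNReal.tsum_add]
  refine tsum_congr fun M => tsum_congr fun c => ?_
  split_ifs <;> simp [add_mul]

theorem stepMass_zero (p : Fin N) (L : Layout n N) : stepMass p (fun _ => 0) L = 0 := by
  simp [stepMass]

theorem stepMass_sum {ι : Type*} (s : Finset ι) (p : Fin N) (F : ι → Layout n N → ℝ≥0∞)
    (L : Layout n N) :
    stepMass p (fun L => ∑ i ∈ s, F i L) L = ∑ i ∈ s, stepMass p (F i) L := by
  classical
  induction s using Finset.induction_on with
  | empty => simp [stepMass_zero]
  | insert i s hi ih => simp_rw [Finset.sum_insert hi, stepMass_add, ih]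

/-- `F` only charges layouts whose buffer holds `s` blocks. -/
def ChargesCard (s : ℕ) (F : Layout n N → ℝ≥0∞) : Prop :=
  ∀ L, L.buffer.card ≠ s → F L = 0

theorem card_step {L : Layout n N} {p : Fin N} {i j : Fin n} (hi : i ∈ L.buffer)
    (hj : j ∈ L.bufferᶜ) : (L.step ⟨p, i, j⟩).buffer.card = L.buffer.card := by
  have h : j ∉ L.buffer.erase i := fun h => Finset.mem_compl.1 hj (Finset.mem_of_mem_erase h)
  rw [Layout.step, Finset.card_insert_of_notMem h, Finset.card_erase_add_one hi]

theorem ChargesCard.stepMass {s : ℕ} {F : Layout n N → ℝ≥0∞} (hF : ChargesCard s F) (p : Fin N) :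
    ChargesCard s (stepMass p F) := by
  classical
  intro L hL
  have h := tsum_stepMass_mul p F (fun M => if M = L then 1 else 0)
  rw [tsum_eq_single L (fun M hM => by simp [hM])] at h
  rw [if_pos rfl, mul_one] at h
  rw [h, ENNReal.tsum_eq_zero]
  intro M
  by_cases hM : M.buffer.card = s
  · rw [stepMean, Finset.sum_eq_zero, mul_zero, mul_zero]
    refine fun i hi => Finset.sum_eq_zero fun j hj => if_neg ?_
    rintro rfl
    exact hL ((card_step hi hj).trans hM)
  · rw [hF M hM, zero_mul]

theorem stepMean_const (p : Fin N) (x : ℝ≥0∞) {L : Layout n N} (h0 : L.buffer.card ≠ 0)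
    (hn : L.buffer.card < n) : stepMean p (fun _ => x) L = (N : ℝ≥0∞)⁻¹ * x := by
  have hc : L.bufferᶜ.card ≠ 0 := by
    rw [Finset.card_compl, Fintype.card_fin]; omega
  simp only [stepMean, Finset.sum_const, nsmul_eq_mul]
  have h1 : (L.buffer.card : ℝ≥0∞)⁻¹ * L.buffer.card = 1 :=
    ENNReal.inv_mul_cancel (by exact_mod_cast h0) (ENNReal.natCast_ne_top _)
  have h2 : (L.bufferᶜ.card : ℝ≥0∞)⁻¹ * L.bufferᶜ.card = 1 :=
    ENNReal.inv_mul_cancel (by exact_mod_cast hc) (ENNReal.natCast_ne_top _)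
  calc _ = (N : ℝ≥0∞)⁻¹ * ((L.buffer.card : ℝ≥0∞)⁻¹ * L.buffer.card) *
        ((L.bufferᶜ.card : ℝ≥0∞)⁻¹ * L.bufferᶜ.card) * x := by ring
    _ = _ := by rw [h1, h2, mul_one, mul_one]

theorem tsum_stepMass {s : ℕ} (hs : s ≠ 0) (hsn : s < n) {F : Layout n N → ℝ≥0∞}
    (hF : ChargesCard s F) (p : Fin N) :
    ∑' L, stepMass p F L = (N : ℝ≥0∞)⁻¹ * ∑' L, F L := by
  have h := tsum_stepMass_mul p F (fun _ => 1)
  simp only [mul_one] at h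
  rw [h, ← ENNReal.tsum_mul_left]
  refine tsum_congr fun L => ?_
  by_cases hL : L.buffer.card = s
  · rw [stepMean_const p 1 (by omega) (by omega), mul_one, mul_comm]
  · simp [hF L hL]

/-! ### Invariance under renaming blocks -/

/-- Blocks may be renamed in `F`, as far as the buffer and the positions in `C` are concerned. -/
def InvariantOn (C : Finset (Fin N)) (F : Layout n N → ℝ≥0∞) : Prop :=
  ∀ φ : Layout n N → ℝ≥0∞,
    (∀ L M, L.buffer = M.buffer → (∀ p ∈ C, L.store p = M.store p) → φ L = φ M) →
      ∀ π, ∑' L, F L * φ (L.relabel π) = ∑' L, F L * φ L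

theorem InvariantOn.add {C : Finset (Fin N)} {F G : Layout n N → ℝ≥0∞} (hF : InvariantOn C F)
    (hG : InvariantOn C G) : InvariantOn C fun L => F L + G L := by
  intro φ hφ π
  simp_rw [add_mul]
  rw [ENNReal.tsum_add, ENNReal.tsum_add, hF φ hφ π, hG φ hφ π]

theorem InvariantOn.zero {C : Finset (Fin N)} : InvariantOn C fun _ : Layout n N => 0 := by
  intro φ hφ π
  simp

theorem InvariantOn.sum {ι : Type*} (s : Finset ι) {C : Finset (Fin N)}
    {F : ι → Layout n N → ℝ≥0∞} (hF : ∀ i ∈ s, InvariantOn C (F i)) :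
    InvariantOn C fun L => ∑ i ∈ s, F i L := by
  classical
  induction s using Finset.induction_on with
  | empty => simpa using InvariantOn.zero
  | insert i s hi ih =>
    simp_rw [Finset.sum_insert hi]
    exact (hF i (Finset.mem_insert_self i s)).add
      (ih fun j hj => hF j (Finset.mem_insert_of_mem hj))

/-- When all positions are controlled, indicators of single layouts are admissible test functions.
-/
theorem InvariantOn.relabel_eq {F : Layout n N → ℝ≥0∞} (hF : InvariantOn Finset.univ F)
    (L : Layout n N) (π : Equiv.Perm (Fin n)) : F (L.relabel π) = F L := by
  classical
  have hinj : ∀ M : Layout n N, M.relabel π = L.relabel π → M = L := by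
    rintro ⟨A, f⟩ h
    rcases L with ⟨B, g⟩
    simp only [Layout.relabel, Layout.mk.injEq, Finset.map_inj] at h ⊢
    exact ⟨h.1, funext fun p => π.injective (congrFun h.2 p)⟩
  have h := hF (fun M => if M = L.relabel π then 1 else 0) (by
    rintro ⟨A, f⟩ ⟨B, g⟩ h1 h2
    obtain rfl : A = B := h1
    obtain rfl : f = g := funext fun p => h2 p (Finset.mem_univ p)
    rfl) π
  rw [tsum_eq_single L, tsum_eq_single (L.relabel π)] at h
  · simpa using h.symm
  · intro M hM; simp [hM]
  · intro M hM; rw [if_neg (fun h => hM (hinj M h)), mul_zero]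

theorem stepMean_relabel (p : Fin N) (φ : Layout n N → ℝ≥0∞) (L : Layout n N)
    (π : Equiv.Perm (Fin n)) :
    stepMean p φ (L.relabel π) = stepMean p (fun M => φ (M.relabel π)) L := by
  have hc : (L.buffer.map π.toEmbedding)ᶜ = L.bufferᶜ.map π.toEmbedding := by
    ext x; simp
  have hs : ∀ i j, (L.relabel π).step ⟨p, π i, π j⟩ = (L.step ⟨p, i, j⟩).relabel π := by
    intro i j
    simp only [Layout.relabel, Layout.step, Layout.mk.injEq]
    constructor
    · rw [Finset.map_insert, Finset.map_erase]; rfl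
    · funext q
      by_cases hq : q = p
      · subst hq; simp
      · simp [hq]
  simp only [stepMean, Layout.relabel, Finset.card_map, hc, Finset.sum_map]
  congr 1
  refine Finset.sum_congr rfl fun i _ => Finset.sum_congr rfl fun j _ => ?_
  exact congrArg φ (hs i j)

/-- The new content of `p` comes from the buffer, so a test function of the buffer and `insert p C`
after the round averages to one of the buffer and `C` before it. Averaging commutes with renaming
because the round treats all blocks alike. -/
theorem InvariantOn.stepMass {C : Finset (Fin N)} {F : Layout n N → ℝ≥0∞} (hF : InvariantOn C F)
    (p : Fin N) : InvariantOn (insert p C) (stepMass p F) := by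
  intro φ hφ π
  rw [tsum_stepMass_mul, tsum_stepMass_mul, ← hF (stepMean p φ) _ π]
  · simp_rw [stepMean_relabel]
  · intro L M h1 h2
    simp only [stepMean, h1]
    congr 1
    refine Finset.sum_congr rfl fun i _ => Finset.sum_congr rfl fun j _ => ?_
    refine hφ _ _ ?_ ?_
    · simp [Layout.step, h1]
    · intro q hq
      by_cases hqp : q = p
      · subst hqp; simp [Layout.step]
      · simpa [Layout.step, hqp] using h2 q (Finset.mem_of_mem_insert_of_ne hq hqp)

/-! ### The chain of buffers -/

/-- The mass of the layouts with buffer `U`. -/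
noncomputable def bufferMass (F : Layout n N → ℝ≥0∞) (U : Finset (Fin n)) : ℝ≥0∞ :=
  ∑' L, F L * if L.buffer = U then 1 else 0

theorem tsum_mul_buffer (F : Layout n N → ℝ≥0∞) (g : Finset (Fin n) → ℝ≥0∞) :
    ∑' L, F L * g L.buffer = ∑ U, bufferMass F U * g U := by
  simp_rw [bufferMass, ← ENNReal.tsum_mul_right]
  rw [← tsum_fintype (L := .unconditional _), ENNReal.tsum_comm]
  refine tsum_congr fun L => ?_
  rw [tsum_eq_single L.buffer]
  · simp
  · intro U hU; simp [hU.symm]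

theorem tsum_eq_sum_bufferMass (F : Layout n N → ℝ≥0∞) :
    ∑' L, F L = ∑ U, bufferMass F U := by
  simpa using tsum_mul_buffer F fun _ => 1

theorem bufferMass_mul_buffer (F : Layout n N → ℝ≥0∞) (g : Finset (Fin n) → ℝ≥0∞)
    (U : Finset (Fin n)) :
    bufferMass (fun L => F L * g L.buffer) U = bufferMass F U * g U := by
  rw [bufferMass, bufferMass, ← ENNReal.tsum_mul_right]
  refine tsum_congr fun L => ?_
  by_cases h : L.buffer = U <;> simp [h]

theorem invariantOn_empty_of_bufferMass {F : Layout n N → ℝ≥0∞}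
    (h : ∀ U (π : Equiv.Perm (Fin n)), bufferMass F (U.map π.toEmbedding) = bufferMass F U) :
    InvariantOn ∅ F := by
  intro φ hφ π
  by_cases hN : Nonempty (Layout n N)
  swap
  · rw [not_nonempty_iff] at hN
    simp
  obtain ⟨L₁⟩ := hN
  -- With `C` empty the test function ignores the store, which may be frozen at an arbitrary value.
  set g : Finset (Fin n) → ℝ≥0∞ := fun U => φ ⟨U, L₁.store⟩ with hg
  have h1 : ∀ L, φ L = g L.buffer := fun L => hφ _ _ rfl (by simp)
  simp_rw [h1]
  have h2 := tsum_mul_buffer F (fun U => g (U.map π.toEmbedding))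
  refine (Eq.trans ?_ h2).trans ?_
  · rfl
  rw [tsum_mul_buffer]
  refine (Finset.sum_congr rfl fun U _ => ?_).trans
    ((Equiv.sum_comp (Equiv.finsetCongr π) fun U => bufferMass F U * g U))
  rw [Equiv.finsetCongr_apply, h U π]

/-- One step of the chain of buffers, on functions on buffers; by symmetry of the chain, this is
both the evolution of densities and the averaging operator. -/
noncomputable def bufferStep (a : Finset (Fin n) → ℝ≥0∞) (U : Finset (Fin n)) : ℝ≥0∞ :=
  (U.card : ℝ≥0∞)⁻¹ * (Uᶜ.card : ℝ≥0∞)⁻¹ * ∑ i ∈ U, ∑ j ∈ Uᶜ, a (insert j (U.erase i))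

/-- An exchange is undone by the reverse exchange. This is the symmetry that makes the chain of
buffers reversible. -/
theorem swap_eq_iff {U V : Finset (Fin n)} {i j : Fin n} :
    (i ∈ U ∧ j ∉ U ∧ insert j (U.erase i) = V) ↔
      (j ∈ V ∧ i ∉ V ∧ insert i (V.erase j) = U) := by
  have key : ∀ {U V : Finset (Fin n)} {i j : Fin n},
      (i ∈ U ∧ j ∉ U ∧ insert j (U.erase i) = V) →
      (j ∈ V ∧ i ∉ V ∧ insert i (V.erase j) = U) := by
    rintro U V i j ⟨hi, hj, rfl⟩
    have hij : i ≠ j := fun h => hj (h ▸ hi)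
    refine ⟨Finset.mem_insert_self _ _, by simp [hij], ?_⟩
    rw [Finset.erase_insert (fun h => hj (Finset.mem_of_mem_erase h)), Finset.insert_erase hi]
  exact ⟨key, key⟩

/-- The exchange does not depend on the position, hence the separate factor `N⁻¹`; reversibility
turns the sum over predecessors of `U` into a sum over its neighbours. -/
theorem bufferMass_stepMass {s : ℕ} {F : Layout n N → ℝ≥0∞} (hF : ChargesCard s F) (p : Fin N)
    {U : Finset (Fin n)} (hU : U.card = s) :
    bufferMass (stepMass p F) U = (N : ℝ≥0∞)⁻¹ * bufferStep (bufferMass F) U := by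
  rw [bufferMass, tsum_stepMass_mul]
  have h1 : ∀ L : Layout n N, F L * stepMean p (fun L => if L.buffer = U then 1 else 0) L =
      F L * ((N : ℝ≥0∞)⁻¹ * ((U.card : ℝ≥0∞)⁻¹ * (Uᶜ.card : ℝ≥0∞)⁻¹ *
        ∑ i ∈ U, ∑ j ∈ Uᶜ, if L.buffer = insert j (U.erase i) then 1 else 0)) := by
    intro L
    by_cases hL : L.buffer.card = s
    swap
    · rw [hF L hL, zero_mul, zero_mul]
    have hLc : L.bufferᶜ.card = Uᶜ.card := by rw [Finset.card_compl, Finset.card_compl, hL, hU]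
    rw [stepMean, hLc, hL, ← hU]
    simp only [mul_assoc]
    congr 4
    have e : ∀ (A : Finset (Fin n)) (f : Fin n → Fin n → ℝ≥0∞), ∑ i ∈ A, ∑ j ∈ Aᶜ, f i j =
        ∑ i, ∑ j, if i ∈ A ∧ j ∉ A then f i j else 0 := by
      intro A f
      rw [← Finset.sum_filter_add_sum_filter_not Finset.univ (· ∈ A)
        (fun i => ∑ j, if i ∈ A ∧ j ∉ A then f i j else 0)]
      rw [Finset.sum_eq_zero (s := Finset.univ.filter fun i => i ∉ A), add_zero,
        Finset.filter_mem_eq_inter, Finset.univ_inter]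
      · refine Finset.sum_congr rfl fun i hi => ?_
        rw [← Finset.sum_filter]
        refine Finset.sum_congr ?_ fun _ _ => rfl
        ext j; simp [hi]
      · intro i hi
        simp [(Finset.mem_filter.1 hi).2]
    rw [e, e, Finset.sum_comm]
    refine Finset.sum_congr rfl fun i _ => Finset.sum_congr rfl fun j _ => ?_
    rw [← ite_and, ← ite_and]
    refine if_congr ?_ rfl rfl
    have := swap_eq_iff (U := L.buffer) (V := U) (i := j) (j := i)
    rw [and_assoc, and_assoc, eq_comm (a := L.buffer)]
    exact this
  simp_rw [h1]
  have h2 := tsum_mul_buffer F (fun V => (N : ℝ≥0∞)⁻¹ * ((U.card : ℝ≥0∞)⁻¹ * (Uᶜ.card : ℝ≥0∞)⁻¹ *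
        ∑ i ∈ U, ∑ j ∈ Uᶜ, if V = insert j (U.erase i) then 1 else 0))
  rw [h2, bufferStep]
  have h3 : ∀ V, bufferMass F V * ((N : ℝ≥0∞)⁻¹ * ((U.card : ℝ≥0∞)⁻¹ * (Uᶜ.card : ℝ≥0∞)⁻¹ *
        ∑ i ∈ U, ∑ j ∈ Uᶜ, if V = insert j (U.erase i) then 1 else 0)) =
      (N : ℝ≥0∞)⁻¹ * ((U.card : ℝ≥0∞)⁻¹ * (Uᶜ.card : ℝ≥0∞)⁻¹ *
        ∑ i ∈ U, ∑ j ∈ Uᶜ, if V = insert j (U.erase i) then bufferMass F V else 0) := by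
    intro V
    rw [mul_left_comm, mul_left_comm (bufferMass F V)]
    simp_rw [Finset.mul_sum (a := bufferMass F V), mul_ite, mul_one, mul_zero]
  simp_rw [h3]
  rw [← Finset.mul_sum, ← Finset.mul_sum, Finset.sum_comm]
  congr 2
  refine Finset.sum_congr rfl fun i _ => ?_
  rw [Finset.sum_comm]
  refine Finset.sum_congr rfl fun j _ => ?_
  simp


/-! ### Coupon collection -/

/-- The expected number of uniform draws of a position that are needed to draw each of those which
remain when `c` of the `N` positions have been drawn. -/
noncomputable def couponTime (N c : ℕ) : ℝ≥0∞ :=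
  (N : ℝ≥0∞) * ∑ i ∈ Finset.range (N - c), ((i + 1 : ℕ) : ℝ≥0∞)⁻¹

theorem couponTime_self (N : ℕ) : couponTime N N = 0 := by simp [couponTime]

/-- First-step analysis: with `y = N - C.card` positions missing, a draw hits a new one with
probability `y / N`, and `couponTime` drops by `N / y` when it does. -/
theorem couponTime_step {C : Finset (Fin N)} (hC : C ≠ Finset.univ) :
    (N : ℝ≥0∞)⁻¹ * ∑ p, couponTime N (insert p C).card + 1 = couponTime N C.card := by
  have hlt : C.card < N := by
    simpa using Finset.card_lt_card (Finset.ssubset_univ_iff.2 hC)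
  obtain ⟨d, hd⟩ : ∃ d, N = C.card + (d + 1) := ⟨N - C.card - 1, by omega⟩
  set x := couponTime N (C.card + 1) with hx
  have hsucc : couponTime N C.card = x + N * ((d + 1 : ℕ) : ℝ≥0∞)⁻¹ := by
    rw [hx, couponTime, couponTime, show N - C.card = d + 1 by omega,
      show N - (C.card + 1) = d by omega, Finset.sum_range_succ, mul_add]
  have hsum : ∑ p, couponTime N (insert p C).card =
      C.card * couponTime N C.card + ((d + 1 : ℕ) : ℝ≥0∞) * x := by
    rw [← Finset.sum_filter_add_sum_filter_not Finset.univ (· ∈ C)]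
    congr 1
    · rw [Finset.sum_congr rfl (g := fun _ => couponTime N C.card)]
      · simp
      · intro p hp
        rw [Finset.insert_eq_of_mem (Finset.mem_filter.1 hp).2]
    · rw [Finset.sum_congr rfl (g := fun _ => x)]
      · have : (Finset.univ.filter fun p => p ∉ C) = Cᶜ := by ext; simp
        rw [Finset.sum_const, this, Finset.card_compl, Fintype.card_fin, nsmul_eq_mul,
          show N - C.card = d + 1 by omega]
      · intro p hp
        rw [Finset.card_insert_of_notMem (Finset.mem_filter.1 hp).2]
  have hN : (N : ℝ≥0∞)⁻¹ * N = 1 :=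
    ENNReal.inv_mul_cancel (by simp; omega) (ENNReal.natCast_ne_top _)
  have h1 : ((d + 1 : ℕ) : ℝ≥0∞) * ((d + 1 : ℕ) : ℝ≥0∞)⁻¹ = 1 :=
    ENNReal.mul_inv_cancel (by simp) (ENNReal.natCast_ne_top _)
  have hcast : (N : ℝ≥0∞) = C.card + ((d + 1 : ℕ) : ℝ≥0∞) := by exact_mod_cast hd
  set y := ((d + 1 : ℕ) : ℝ≥0∞)
  rw [hsum, hsucc]
  calc (N : ℝ≥0∞)⁻¹ * (C.card * (x + N * y⁻¹) + y * x) + 1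
      = (N : ℝ≥0∞)⁻¹ * ((C.card + y) * x) + ((N : ℝ≥0∞)⁻¹ * N) * (C.card * y⁻¹) + y * y⁻¹ := by
        rw [h1]; ring
    _ = ((N : ℝ≥0∞)⁻¹ * N) * x + (C.card + y) * y⁻¹ := by
        rw [← hcast, hN, ← mul_assoc, hN, one_mul, one_mul, add_assoc, ← add_mul, ← hcast]
    _ = _ := by rw [hN, one_mul, ← hcast]

/-! ### Marking the buffer, then covering all positions -/

section Construction

variable (L₀ : Layout n N) (η : ℕ → Finset (Fin n) → ℝ≥0∞)

/-- The mass of the runs with access pattern `w` in which the buffer has not been marked as mixed,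
where `η t` is the probability of marking a buffer at time `t`. -/
noncomputable def unmarkedMass : List (Fin N) → Layout n N → ℝ≥0∞
  | [], L => open Classical in if L = L₀ then 1 else 0
  | p :: w, L => stepMass p (unmarkedMass w) L * (1 - η (w.length + 1) L.buffer)

/-- The mass of the runs with access pattern `w` in which the buffer is marked as mixed at the end
of `w`. -/
noncomputable def markedMass : List (Fin N) → Layout n N → ℝ≥0∞
  | [], _ => 0
  | p :: w, L => stepMass p (unmarkedMass L₀ η w) L * η (w.length + 1) L.buffer

/-- The mass of the runs with access pattern `w` in which the buffer has been marked as mixed, and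
the set of positions processed since then is `C`; runs end when `C` is everything. -/
noncomputable def coveredMass : List (Fin N) → Finset (Fin N) → Layout n N → ℝ≥0∞
  | [], _, _ => 0
  | p :: w, C', L => (∑ C ∈ Finset.univ.filter (· ≠ Finset.univ) with insert p C = C',
      stepMass p (coveredMass w C) L) + if C' = ∅ then markedMass L₀ η (p :: w) L else 0

theorem sum_fiberwise_insert_mul (p : Fin N) (A : Finset (Finset (Fin N)))
    (f g : Finset (Fin N) → ℝ≥0∞) :
    ∑ C', (∑ C ∈ A with insert p C = C', f C) * g C' = ∑ C ∈ A, f C * g (insert p C) := by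
  rw [← Finset.sum_fiberwise (s := A) (g := fun C => insert p C)]
  refine Finset.sum_congr rfl fun C' _ => ?_
  rw [Finset.sum_mul]
  refine Finset.sum_congr rfl fun C hC => ?_
  rw [(Finset.mem_filter.1 hC).2]

variable {L₀ η} {s : ℕ}

theorem chargesCard_unmarkedMass (hL₀ : L₀.buffer.card = s) (w : List (Fin N)) :
    ChargesCard s (unmarkedMass L₀ η w) := by
  induction w with
  | nil =>
    intro L hL
    rw [unmarkedMass, if_neg]
    rintro rfl
    exact hL hL₀
  | cons p w ih =>
    intro L hL
    rw [unmarkedMass, ih.stepMass p L hL, zero_mul]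

theorem chargesCard_markedMass (hL₀ : L₀.buffer.card = s) (w : List (Fin N)) :
    ChargesCard s (markedMass L₀ η w) := by
  intro L hL
  cases w with
  | nil => rfl
  | cons p w => rw [markedMass, (chargesCard_unmarkedMass hL₀ w).stepMass p L hL, zero_mul]

theorem chargesCard_coveredMass (hL₀ : L₀.buffer.card = s) (w : List (Fin N))
    (C : Finset (Fin N)) : ChargesCard s (coveredMass L₀ η w C) := by
  induction w generalizing C with
  | nil => intro L hL; rfl
  | cons p w ih =>
    intro L hL
    rw [coveredMass, Finset.sum_eq_zero fun C _ => (ih C).stepMass p L hL,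
      chargesCard_markedMass hL₀ _ L hL, ite_self, add_zero]

theorem unmarkedMass_add_markedMass (hη : ∀ t U, η t U ≤ 1) (p : Fin N) (w : List (Fin N))
    (L : Layout n N) :
    unmarkedMass L₀ η (p :: w) L + markedMass L₀ η (p :: w) L =
      stepMass p (unmarkedMass L₀ η w) L := by
  rw [unmarkedMass, markedMass, ← mul_add, tsub_add_cancel_of_le (hη _ _), mul_one]

/-- At marking only the buffer is symmetric, and the position of the marking round is not counted,
so covering starts from `∅`. Each later round adds its position to the controlled set. -/
theorem invariantOn_coveredMass (hm : ∀ w, InvariantOn ∅ (markedMass L₀ η w))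
    (w : List (Fin N)) (C : Finset (Fin N)) : InvariantOn C (coveredMass L₀ η w C) := by
  induction w generalizing C with
  | nil => exact InvariantOn.zero
  | cons p w ih =>
    refine InvariantOn.add (InvariantOn.sum _ fun D hD => ?_) ?_
    · have h := (ih D).stepMass p
      rwa [(Finset.mem_filter.1 hD).2] at h
    · by_cases hC : C = ∅
      · subst hC
        simpa using hm (p :: w)
      · simpa [hC] using InvariantOn.zero

/-- The mass of the runs with access pattern `w` that have not ended. -/
noncomputable def runningMass (L₀ : Layout n N) (η : ℕ → Finset (Fin n) → ℝ≥0∞)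
    (w : List (Fin N)) (L : Layout n N) : ℝ≥0∞ :=
  unmarkedMass L₀ η w L +
    ∑ C ∈ Finset.univ.filter (· ≠ Finset.univ), coveredMass L₀ η w C L

theorem runningMass_add_coveredMass (hη : ∀ t U, η t U ≤ 1) (p : Fin N) (w : List (Fin N))
    (L : Layout n N) :
    runningMass L₀ η (p :: w) L + coveredMass L₀ η (p :: w) Finset.univ L =
      stepMass p (runningMass L₀ η w) L := by
  have h1 : ∑ C ∈ Finset.univ.filter (· ≠ Finset.univ), coveredMass L₀ η (p :: w) C L +
      coveredMass L₀ η (p :: w) Finset.univ L = ∑ C, coveredMass L₀ η (p :: w) C L := by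
    rw [← Finset.sum_filter_add_sum_filter_not Finset.univ (· ≠ Finset.univ)]
    simp [Finset.filter_eq']
  have h2 : ∑ C, coveredMass L₀ η (p :: w) C L =
      ∑ C ∈ Finset.univ.filter (· ≠ Finset.univ), stepMass p (coveredMass L₀ η w C) L +
        markedMass L₀ η (p :: w) L := by
    simp_rw [coveredMass]
    rw [Finset.sum_add_distrib, Finset.sum_fiberwise]
    simp
  have h3 : stepMass p (runningMass L₀ η w) L = stepMass p (unmarkedMass L₀ η w) L +
      ∑ C ∈ Finset.univ.filter (· ≠ Finset.univ), stepMass p (coveredMass L₀ η w C) L := by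
    rw [← stepMass_sum, ← stepMass_add]
    rfl
  rw [h3, ← unmarkedMass_add_markedMass hη, runningMass, add_assoc, h1, h2]
  ring

theorem chargesCard_runningMass (hL₀ : L₀.buffer.card = s) (w : List (Fin N)) :
    ChargesCard s (runningMass L₀ η w) := by
  intro L hL
  rw [runningMass, chargesCard_unmarkedMass hL₀ w L hL,
    Finset.sum_eq_zero fun C _ => chargesCard_coveredMass hL₀ w C L hL, add_zero]

theorem sum_inv_card_mul (hN : N ≠ 0) (x : ℝ≥0∞) : ∑ _p : Fin N, (N : ℝ≥0∞)⁻¹ * x = x := by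
  rw [Finset.sum_const, Finset.card_univ, Fintype.card_fin, nsmul_eq_mul, ← mul_assoc,
    ENNReal.mul_inv_cancel (by simpa using hN) (ENNReal.natCast_ne_top N), one_mul]

theorem level_unmarked_add_level_marked (hN : N ≠ 0) (hs : s ≠ 0) (hsn : s < n)
    (hη : ∀ t U, η t U ≤ 1) (hL₀ : L₀.buffer.card = s) (t : ℕ) :
    level (fun w => ∑' L, unmarkedMass L₀ η w L) (t + 1) +
      level (fun w => ∑' L, markedMass L₀ η w L) (t + 1) =
      level (fun w => ∑' L, unmarkedMass L₀ η w L) t := by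
  rw [← level_add, level_succ]
  congr 1
  ext w
  simp_rw [← ENNReal.tsum_add, unmarkedMass_add_markedMass hη,
    tsum_stepMass hs hsn (chargesCard_unmarkedMass hL₀ w)]
  exact sum_inv_card_mul hN _

theorem level_running_add_level_covered (hN : N ≠ 0) (hs : s ≠ 0) (hsn : s < n)
    (hη : ∀ t U, η t U ≤ 1) (hL₀ : L₀.buffer.card = s) (t : ℕ) :
    level (fun w => ∑' L, runningMass L₀ η w L) (t + 1) +
      level (fun w => ∑' L, coveredMass L₀ η w Finset.univ L) (t + 1) =
      level (fun w => ∑' L, runningMass L₀ η w L) t := by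
  rw [← level_add, level_succ]
  congr 1
  ext w
  simp_rw [← ENNReal.tsum_add, runningMass_add_coveredMass hη,
    tsum_stepMass hs hsn (chargesCard_runningMass hL₀ w)]
  exact sum_inv_card_mul hN _

theorem tsum_finset_sum {ι β : Type*} (A : Finset ι) (f : ι → β → ℝ≥0∞) :
    ∑' b, ∑ i ∈ A, f i b = ∑ i ∈ A, ∑' b, f i b :=
  Summable.tsum_finsetSum fun _ _ => ENNReal.summable

/-- The expected remaining coupon time is the potential: a round lowers it by the mass still
collecting and raises it by `couponTime N 0` per unit of newly marked mass. -/
theorem covered_potential_step (hs : s ≠ 0) (hsn : s < n)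
    (hL₀ : L₀.buffer.card = s) (w : List (Fin N)) :
    (∑ p, ∑ C, (∑' L, coveredMass L₀ η (p :: w) C L) * couponTime N C.card) +
      ∑ C ∈ Finset.univ.filter (· ≠ Finset.univ), ∑' L, coveredMass L₀ η w C L =
    (∑ C, (∑' L, coveredMass L₀ η w C L) * couponTime N C.card) +
      couponTime N 0 * ∑ p, ∑' L, markedMass L₀ η (p :: w) L := by
  have h1 : ∀ p C', ∑' L, coveredMass L₀ η (p :: w) C' L =
      (∑ C ∈ Finset.univ.filter (· ≠ Finset.univ) with insert p C = C',
        (N : ℝ≥0∞)⁻¹ * ∑' L, coveredMass L₀ η w C L) +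
      if C' = ∅ then ∑' L, markedMass L₀ η (p :: w) L else 0 := by
    intro p C'
    simp_rw [coveredMass]
    rw [ENNReal.tsum_add, tsum_finset_sum]
    congr 1
    · exact Finset.sum_congr rfl fun C _ =>
        tsum_stepMass hs hsn (chargesCard_coveredMass hL₀ w C) p
    · split_ifs <;> simp
  have h2 : ∀ p, ∑ C, (∑' L, coveredMass L₀ η (p :: w) C L) * couponTime N C.card =
      (∑ C ∈ Finset.univ.filter (· ≠ Finset.univ), (∑' L, coveredMass L₀ η w C L) *
        ((N : ℝ≥0∞)⁻¹ * couponTime N (insert p C).card)) +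
        couponTime N 0 * ∑' L, markedMass L₀ η (p :: w) L := by
    intro p
    simp_rw [h1, add_mul]
    rw [Finset.sum_add_distrib, sum_fiberwise_insert_mul p _ _ fun C => couponTime N C.card]
    congr 1
    · exact Finset.sum_congr rfl fun C _ => by ring
    · simp [mul_comm]
  simp_rw [h2]
  rw [Finset.sum_add_distrib, Finset.sum_comm, ← Finset.mul_sum, add_right_comm,
    ← Finset.sum_add_distrib]
  congr 1
  rw [← Finset.sum_filter_add_sum_filter_not Finset.univ (· ≠ (Finset.univ : Finset (Fin N)))]
  have h3 : ∑ C ∈ Finset.univ.filter (fun C => ¬ C ≠ (Finset.univ : Finset (Fin N))),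
      (∑' L, coveredMass L₀ η w C L) * couponTime N C.card = 0 := by
    refine Finset.sum_eq_zero fun C hC => ?_
    rw [not_not.1 (Finset.mem_filter.1 hC).2, Finset.card_univ, Fintype.card_fin,
      couponTime_self, mul_zero]
  rw [h3, add_zero]
  refine Finset.sum_congr rfl fun C hC => ?_
  rw [← couponTime_step (Finset.mem_filter.1 hC).2, ← Finset.mul_sum, ← Finset.mul_sum, mul_add,
    mul_one]

theorem tsum_level_covered_le (hN : N ≠ 0) (hs : s ≠ 0) (hsn : s < n)
    (hη : ∀ t U, η t U ≤ 1) (hL₀ : L₀.buffer.card = s) :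
    ∑' t, level (fun w => ∑ C ∈ Finset.univ.filter (· ≠ Finset.univ),
      ∑' L, coveredMass L₀ η w C L) t ≤ couponTime N 0 := by
  set K := level (fun w => ∑ C ∈ Finset.univ.filter (· ≠ (Finset.univ : Finset (Fin N))),
      ∑' L, coveredMass L₀ η w C L) with hK
  set Ψ := level (fun w => ∑ C, (∑' L, coveredMass L₀ η w C L) * couponTime N C.card) with hΨ
  set b := level (fun w => ∑' L, unmarkedMass L₀ η w L) with hb
  set m := level (fun w => ∑' L, markedMass L₀ η w L) with hm
  have hstep : ∀ t, Ψ (t + 1) + K t = Ψ t + couponTime N 0 * m (t + 1) := by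
    intro t
    rw [hΨ, hK, hm, level_succ, level_succ, ← level_mul_left, ← level_add, ← level_add]
    congr 1
    ext w
    exact covered_potential_step hs hsn hL₀ w
  have hbm : ∀ t, b (t + 1) + m (t + 1) = b t :=
    level_unmarked_add_level_marked hN hs hsn hη hL₀
  -- Conserved quantity: time already spent collecting, plus time still owed by marked runs, plus a
  -- full collection owed by each unmarked run.
  have htot : ∀ t, ∑ i ∈ Finset.range t, K i + Ψ t + couponTime N 0 * b t = couponTime N 0 := by
    intro t
    induction t with
    | zero =>
      have h1 : b 0 = 1 := by
        rw [hb, level_zero]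
        simp [unmarkedMass]
      have h2 : Ψ 0 = 0 := by
        rw [hΨ, level_zero]
        simp [coveredMass]
      simp [h1, h2]
    | succ t ih =>
      rw [Finset.sum_range_succ]
      calc _ = ∑ i ∈ Finset.range t, K i + (Ψ (t + 1) + K t) + couponTime N 0 * b (t + 1) := by
            ring
        _ = ∑ i ∈ Finset.range t, K i + Ψ t + couponTime N 0 * (b (t + 1) + m (t + 1)) := by
            rw [hstep]; ring
        _ = _ := by rw [hbm, ih]
  refine ENNReal.tsum_le_of_sum_range_le fun t => ?_
  rw [← htot t, add_assoc]
  exact le_self_add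

end Construction

/-- Here `a t` is the unmarked buffer mass at time `t` and `σ t` the mass marked at time `t` on each
buffer of size `s`. Since `σ t` does not depend on the buffer, a marked buffer is uniform. The
expected duration is the total unmarked mass over time plus the coupon time. -/
theorem exists_perfectPrivacy_of_bufferFlow {s : ℕ} (hN : N ≠ 0) (hs : s ≠ 0) (hsn : s < n)
    (L₀ : Layout n N) (hL₀ : L₀.buffer.card = s)
    (a : ℕ → Finset (Fin n) → ℝ≥0∞) (σ : ℕ → ℝ≥0∞)
    (ha : ∀ t U, a t U ≠ ∞) (hσ : ∀ t, σ t ≠ ∞)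
    (h0 : ∀ U, a 0 U = if U = L₀.buffer then 1 else 0)
    (hcard : ∀ t U, U.card ≠ s → a t U = 0)
    (hstep : ∀ t U, U.card = s → bufferStep (a t) U = a (t + 1) U + σ (t + 1))
    (hsum : ∑' t, ∑ U, a t U ≠ ∞) :
    ∃ T : StoppingTime n N, T.AchievesPerfectPrivacy L₀ ∧
      T.expectedRounds L₀ ≤ ∑' t, ∑ U, a t U + couponTime N 0 := by
  classical
  -- Before the marking decision at time `t` buffer `U` carries `a t U + σ t`; this probability
  -- removes exactly `σ t`.
  set η : ℕ → Finset (Fin n) → ℝ≥0∞ := fun t U => if U.card = s then σ t / (a t U + σ t) else 0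
    with hηdef
  have hη : ∀ t U, η t U ≤ 1 := by
    intro t U
    rw [hηdef]
    dsimp only
    split_ifs
    · exact ENNReal.div_le_of_le_mul (by simp)
    · exact zero_le_one
  have hmark : ∀ t U, U.card = s → (a t U + σ t) * η t U = σ t := by
    intro t U hU
    rw [hηdef]
    dsimp only
    rw [if_pos hU]
    by_cases h : a t U + σ t = 0
    · rw [h, zero_mul]; exact (add_eq_zero.1 h).2.symm
    · exact ENNReal.mul_div_cancel h (ENNReal.add_ne_top.2 ⟨ha t U, hσ t⟩)
  have hkeep : ∀ t U, U.card = s → (a t U + σ t) * (1 - η t U) = a t U := by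
    intro t U hU
    have h1 : (a t U + σ t) * (1 - η t U) + σ t = a t U + σ t := by
      calc _ = (a t U + σ t) * (1 - η t U) + (a t U + σ t) * η t U := by rw [hmark t U hU]
        _ = _ := by rw [← mul_add, tsub_add_cancel_of_le (hη t U), mul_one]
    exact (ENNReal.add_left_inj (hσ t)).1 h1
  -- Marking looks only at the time and the buffer, so the access pattern stays uniform and
  -- independent of the unmarked buffer.
  have hbuf : ∀ w : List (Fin N), bufferMass (unmarkedMass L₀ η w) =
      fun U => (N : ℝ≥0∞)⁻¹ ^ w.length * a w.length U := by
    intro w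
    induction w with
    | nil =>
      ext U
      rw [bufferMass, tsum_eq_single L₀]
      · simp [unmarkedMass, h0, eq_comm]
      · intro L hL; simp [unmarkedMass, hL]
    | cons p w ih =>
      ext U
      by_cases hU : U.card = s
      · have h1 := bufferMass_mul_buffer (stepMass p (unmarkedMass L₀ η w))
          (fun U => 1 - η (w.length + 1) U) U
        refine h1.trans ?_
        rw [bufferMass_stepMass (chargesCard_unmarkedMass hL₀ w) p hU, ih]
        have h2 : bufferStep (fun U => (N : ℝ≥0∞)⁻¹ ^ w.length * a w.length U) U =
            (N : ℝ≥0∞)⁻¹ ^ w.length * bufferStep (a w.length) U := by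
          simp_rw [bufferStep, ← Finset.mul_sum]
          ring
        rw [h2, hstep _ _ hU, List.length_cons, pow_succ]
        calc _ = (N : ℝ≥0∞)⁻¹ ^ w.length * (N : ℝ≥0∞)⁻¹ *
              ((a (w.length + 1) U + σ (w.length + 1)) * (1 - η (w.length + 1) U)) := by ring
          _ = _ := by rw [hkeep _ _ hU]
      · rw [hcard _ _ hU, mul_zero, bufferMass, ENNReal.tsum_eq_zero]
        intro L
        by_cases hL : L.buffer = U
        · rw [chargesCard_unmarkedMass hL₀ _ L (hL ▸ hU), zero_mul]
        · rw [if_neg hL, mul_zero]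
  have hinv : ∀ w, InvariantOn ∅ (markedMass L₀ η w) := by
    intro w
    cases w with
    | nil => exact InvariantOn.zero
    | cons p w =>
      have h1 : ∀ U : Finset (Fin n), bufferMass (markedMass L₀ η (p :: w)) U =
          if U.card = s then (N : ℝ≥0∞)⁻¹ ^ (w.length + 1) * σ (w.length + 1) else 0 := by
        intro U
        refine (bufferMass_mul_buffer (stepMass p (unmarkedMass L₀ η w))
          (fun U => η (w.length + 1) U) U).trans ?_
        split_ifs with hU
        · rw [bufferMass_stepMass (chargesCard_unmarkedMass hL₀ w) p hU, hbuf]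
          have h2 : bufferStep (fun U => (N : ℝ≥0∞)⁻¹ ^ w.length * a w.length U) U =
              (N : ℝ≥0∞)⁻¹ ^ w.length * bufferStep (a w.length) U := by
            simp_rw [bufferStep, ← Finset.mul_sum]
            ring
          rw [h2, hstep _ _ hU, pow_succ]
          calc _ = (N : ℝ≥0∞)⁻¹ ^ w.length * (N : ℝ≥0∞)⁻¹ *
                ((a (w.length + 1) U + σ (w.length + 1)) * η (w.length + 1) U) := by ring
            _ = _ := by rw [hmark _ _ hU]
        · rw [hηdef]
          dsimp only
          rw [if_neg hU, mul_zero]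
      refine invariantOn_empty_of_bufferMass fun U π => ?_
      rw [h1, h1, Finset.card_map]
  have hA0 : ∑' L, runningMass L₀ η [] L = 1 := by
    simp [runningMass, unmarkedMass, coveredMass]
  set A := level (fun w => ∑' L, runningMass L₀ η w L) with hA
  set Γ := level (fun w => ∑' L, coveredMass L₀ η w Finset.univ L) with hΓ
  have hAΓ : ∀ t, A (t + 1) + Γ (t + 1) = A t :=
    level_running_add_level_covered hN hs hsn hη hL₀
  have hAΓ0 : A 0 + Γ 0 = 1 := by
    rw [hA, hΓ, level_zero, level_zero, hA0]
    simp [coveredMass]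
  have hAle : ∀ t, A t ≤ 1 := by
    intro t
    induction t with
    | zero => rw [← hAΓ0]; exact le_self_add
    | succ t ih => exact (hAΓ t ▸ le_self_add).trans ih
  have hle : ∀ w L, runningMass L₀ η w L + coveredMass L₀ η w Finset.univ L ≤ 1 := by
    intro w
    have hAw : ∀ w : List (Fin N), ∑' L, runningMass L₀ η w L ≤ 1 := by
      intro w
      refine le_trans ?_ (hAle w.length)
      rw [hA, level]
      refine le_trans ?_ (ENNReal.le_tsum w)
      simp
    cases w with
    | nil =>
      intro L
      simp only [runningMass, coveredMass, unmarkedMass, Finset.sum_const_zero, add_zero]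
      split_ifs <;> simp
    | cons p w =>
      intro L
      rw [runningMass_add_coveredMass hη]
      refine (ENNReal.le_tsum L).trans ?_
      rw [tsum_stepMass hs hsn (chargesCard_runningMass hL₀ w)]
      refine mul_le_one' ?_ (hAw w)
      rw [ENNReal.inv_le_one]
      exact_mod_cast Nat.one_le_iff_ne_zero.2 hN
  obtain ⟨T, hT⟩ := exists_stoppingTime_of_flow L₀ (runningMass L₀ η)
    (fun w => coveredMass L₀ η w Finset.univ)
    (fun w L => ((hle w L).trans_lt ENNReal.one_lt_top).ne)
    (fun L => by simp [runningMass, unmarkedMass, coveredMass])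
    (fun p w L => runningMass_add_coveredMass hη p w L)
  have hsumA : ∑' t, A t ≤ ∑' t, ∑ U, a t U + couponTime N 0 := by
    have h1 : ∀ t, A t = ∑ U, a t U + level (fun w =>
        ∑ C ∈ Finset.univ.filter (· ≠ Finset.univ), ∑' L, coveredMass L₀ η w C L) t := by
      intro t
      rw [hA, ← level_inv_pow_mul hN (fun t => ∑ U, a t U), ← level_add]
      congr 1
      ext w
      simp_rw [runningMass]
      rw [ENNReal.tsum_add, tsum_finset_sum, tsum_eq_sum_bufferMass, hbuf, ← Finset.mul_sum]
    simp_rw [h1]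
    rw [ENNReal.tsum_add]
    gcongr
    exact tsum_level_covered_le hN hs hsn hη hL₀
  have hcoupon : couponTime N 0 ≠ ∞ := by
    refine ENNReal.mul_ne_top (ENNReal.natCast_ne_top _) (ENNReal.sum_ne_top.2 fun i _ => ?_)
    exact ENNReal.inv_ne_top.2 (by simp)
  have hfinA : ∑' t, A t ≠ ∞ :=
    (hsumA.trans_lt (ENNReal.add_lt_top.2 ⟨hsum.lt_top, hcoupon.lt_top⟩)).ne
  refine ⟨T, ⟨?_, fun w L π => ?_⟩, ?_⟩
  · have h := T.tsum_stopProb L₀ fun _ => 1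
    simp only [one_mul, hT] at h
    exact h.trans (tsum_stopped_eq_one hAΓ0 hAΓ hfinA)
  · rw [hT, hT]
    exact (invariantOn_coveredMass hinv w Finset.univ).relabel_eq L π
  · have h := T.tsum_stopProb L₀ fun t => t
    simp only [hT] at h
    exact h.le.trans ((tsum_mul_stopped_le hAΓ).trans hsumA)


/-! ### Projecting the buffer chain to the distance from the initial buffer -/

/-- The generator of the Bernoulli–Laplace chain with urns of sizes `S` and `M`, on functions of the
number of blocks by which a buffer differs from the initial one, times `S * M`. -/
def urnStep (S M : ℝ) (f : ℕ → ℝ) (d : ℕ) : ℝ :=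
  (S - d) * (M - d) * f (d + 1) + (d : ℝ) ^ 2 * f (d - 1) + d * (S + M - 2 * d) * f d

theorem urnStep_comm (S M : ℝ) : urnStep S M = urnStep M S := by
  ext f d
  simp only [urnStep]
  ring

theorem sum_swap_sdiff {U U₀ : Finset (Fin n)} (hU : U.card = U₀.card) (f : ℕ → ℝ) :
    ∑ i ∈ U, ∑ j ∈ Uᶜ, f (insert j (U.erase i) \ U₀).card =
      urnStep U₀.card (n - U₀.card : ℝ) f (U \ U₀).card := by
  set d := (U \ U₀).card with hd
  -- The distance drops by one if the evicted block is foreign to `U₀` and grows by one if the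
  -- admitted block is.
  have hcard : ∀ i ∈ U, ∀ j ∈ Uᶜ, (insert j (U.erase i) \ U₀).card =
      (if j ∈ U₀ then 0 else 1) + (d - if i ∈ U₀ then 0 else 1) := by
    intro i hi j hj
    have hj' : j ∉ U := Finset.mem_compl.1 hj
    have h1 : (U.erase i \ U₀).card = d - if i ∈ U₀ then 0 else 1 := by
      rw [Finset.erase_sdiff_comm]
      split_ifs with h
      · rw [Finset.erase_eq_of_notMem (by simp [h])]; rfl
      · rw [Finset.card_erase_of_mem (by simp [h, hi])]
    split_ifs at h1 ⊢ with h2 h3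
    · rw [Finset.insert_sdiff_of_mem _ h2, h1, zero_add]
    · rw [Finset.insert_sdiff_of_mem _ h2, h1, zero_add]
    · rw [Finset.insert_sdiff_of_notMem _ h2, Finset.card_insert_of_notMem (by simp [hj']), h1,
        add_comm]
    · rw [Finset.insert_sdiff_of_notMem _ h2, Finset.card_insert_of_notMem (by simp [hj']), h1,
        add_comm]
  have c1 : ((U.filter (· ∉ U₀)).card : ℝ) = d := by
    rw [hd]; congr 2; ext x; simp
  have c2 : ((U.filter (· ∈ U₀)).card : ℝ) = U₀.card - d := by
    have h := Finset.card_filter_add_card_filter_not (s := U) (fun x => x ∈ U₀)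
    rw [← c1, ← hU, ← h]; push_cast; ring
  have c3 : ((Uᶜ.filter (· ∈ U₀)).card : ℝ) = d := by
    have h1 : Uᶜ.filter (· ∈ U₀) = U₀ \ U := by ext x; simp [and_comm]
    rw [h1, hd, Finset.card_sdiff_comm hU]
  have c4 : ((Uᶜ.filter (· ∉ U₀)).card : ℝ) = n - U₀.card - d := by
    have h := Finset.card_filter_add_card_filter_not (s := Uᶜ) (fun x => x ∈ U₀)
    have h2 := Finset.card_add_card_compl U
    rw [Fintype.card_fin, ← h, hU] at h2
    have h3 := congrArg (Nat.cast (R := ℝ)) h2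
    push_cast at h3
    rw [c3] at h3
    linarith
  have hinner : ∀ i ∈ U, ∑ j ∈ Uᶜ, f (insert j (U.erase i) \ U₀).card =
      d * f (d - if i ∈ U₀ then 0 else 1) +
        (n - U₀.card - d : ℝ) * f (1 + (d - if i ∈ U₀ then 0 else 1)) := by
    intro i hi
    rw [← Finset.sum_filter_add_sum_filter_not Uᶜ (· ∈ U₀), ← c4, ← c3, ← nsmul_eq_mul,
      ← nsmul_eq_mul, ← Finset.sum_const, ← Finset.sum_const]
    congr 1
    · refine Finset.sum_congr rfl fun j hj => ?_
      rw [hcard i hi j (Finset.mem_filter.1 hj).1, if_pos (Finset.mem_filter.1 hj).2, zero_add]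
    · refine Finset.sum_congr rfl fun j hj => ?_
      rw [hcard i hi j (Finset.mem_filter.1 hj).1, if_neg (Finset.mem_filter.1 hj).2]
  rw [Finset.sum_congr rfl hinner, ← Finset.sum_filter_add_sum_filter_not U (· ∈ U₀)]
  have o1 : ∑ i ∈ U with i ∈ U₀, (d * f (d - if i ∈ U₀ then 0 else 1) +
        (n - U₀.card - d : ℝ) * f (1 + (d - if i ∈ U₀ then 0 else 1))) =
      (U₀.card - d : ℝ) * (d * f d + (n - U₀.card - d : ℝ) * f (1 + d)) := by
    rw [← c2, ← nsmul_eq_mul, ← Finset.sum_const]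
    refine Finset.sum_congr rfl fun i hi => ?_
    rw [if_pos (Finset.mem_filter.1 hi).2, Nat.sub_zero]
  have o2 : ∑ i ∈ U with i ∉ U₀, (d * f (d - if i ∈ U₀ then 0 else 1) +
        (n - U₀.card - d : ℝ) * f (1 + (d - if i ∈ U₀ then 0 else 1))) =
      (d : ℝ) * (d * f (d - 1) + (n - U₀.card - d : ℝ) * f d) := by
    rw [← c1, ← nsmul_eq_mul, ← Finset.sum_const]
    refine Finset.sum_congr rfl fun i hi => ?_
    have hmem := Finset.mem_filter.1 hi
    have hpos : 1 ≤ d := Finset.card_pos.2 ⟨i, Finset.mem_sdiff.2 hmem⟩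
    rw [if_neg hmem.2, show 1 + (d - 1) = d by omega, c1]
  rw [o1, o2, urnStep, add_comm 1 d]
  ring

/-- The total mass of a function of the number of blocks by which a buffer differs from `U₀`. -/
def distTotal (U₀ : Finset (Fin n)) : (ℕ → ℝ) →ₗ[ℝ] ℝ where
  toFun f := ∑ U ∈ Finset.powersetCard U₀.card Finset.univ, f (U \ U₀).card
  map_add' f g := by simp [Finset.sum_add_distrib]
  map_smul' c f := by simp [Finset.mul_sum]

theorem distTotal_apply (U₀ : Finset (Fin n)) (f : ℕ → ℝ) :
    distTotal U₀ f = ∑ U ∈ Finset.powersetCard U₀.card Finset.univ, f (U \ U₀).card := rfl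

theorem card_sdiff_le_card_compl (U U₀ : Finset (Fin n)) : (U \ U₀).card ≤ n - U₀.card := by
  have h : U \ U₀ ⊆ U₀ᶜ := by intro x; simp
  simpa [Finset.card_compl] using Finset.card_le_card h

theorem distTotal_congr (U₀ : Finset (Fin n)) {f g : ℕ → ℝ}
    (h : ∀ d, d ≤ U₀.card → d ≤ n - U₀.card → f d = g d) : distTotal U₀ f = distTotal U₀ g := by
  rw [distTotal_apply, distTotal_apply]
  refine Finset.sum_congr rfl fun U hU => h _ ?_ (card_sdiff_le_card_compl U U₀)
  rw [← (Finset.mem_powersetCard.1 hU).2]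
  exact Finset.card_le_card Finset.sdiff_subset

theorem distTotal_indicator (U₀ : Finset (Fin n)) :
    distTotal U₀ (fun d => if d = 0 then 1 else 0) = 1 := by
  rw [distTotal_apply, Finset.sum_eq_single U₀]
  · simp
  · intro U hU hne
    refine if_neg fun h => hne ?_
    rw [Finset.card_eq_zero, Finset.sdiff_eq_empty_iff_subset] at h
    exact Finset.eq_of_subset_of_card_le h (Finset.mem_powersetCard.1 hU).2.ge
  · intro h
    exact absurd (Finset.mem_powersetCard.2 ⟨Finset.subset_univ _, rfl⟩) h

/-- Conservation of mass: `(U, i, j) ↦ (insert j (U.erase i), j, i)` is an involution on all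
possible exchanges. It yields the normalizing constants below without evaluating binomial sums. -/
theorem distTotal_urnStep (U₀ : Finset (Fin n)) (f : ℕ → ℝ) :
    distTotal U₀ (urnStep U₀.card (n - U₀.card : ℝ) f) =
      (U₀.card : ℝ) * (n - U₀.card : ℝ) * distTotal U₀ f := by
  set s := U₀.card with hs
  have hcard : ∀ U ∈ Finset.powersetCard s (Finset.univ : Finset (Fin n)),
      ((Uᶜ.card : ℕ) : ℝ) = n - s := by
    intro U hU
    have h2 := Finset.card_add_card_compl U
    rw [Fintype.card_fin, (Finset.mem_powersetCard.1 hU).2] at h2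
    have h3 := congrArg (Nat.cast (R := ℝ)) h2
    push_cast at h3
    linarith
  have h1 : distTotal U₀ (urnStep s (n - s : ℝ) f) =
      ∑ U ∈ Finset.powersetCard s Finset.univ, ∑ i ∈ U, ∑ j ∈ Uᶜ,
        f (insert j (U.erase i) \ U₀).card := by
    rw [distTotal_apply]
    exact Finset.sum_congr rfl fun U hU =>
      (sum_swap_sdiff (Finset.mem_powersetCard.1 hU).2 f).symm
  have h2 : (s : ℝ) * (n - s : ℝ) * distTotal U₀ f =
      ∑ U ∈ Finset.powersetCard s Finset.univ, ∑ i ∈ U, ∑ j ∈ Uᶜ, f (U \ U₀).card := by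
    rw [distTotal_apply, Finset.mul_sum]
    refine Finset.sum_congr rfl fun U hU => ?_
    rw [Finset.sum_const, Finset.sum_const, nsmul_eq_mul, nsmul_eq_mul, hcard U hU,
      (Finset.mem_powersetCard.1 hU).2]
    ring
  rw [h1, h2]
  simp_rw [← Finset.sum_product']
  rw [Finset.sum_sigma', Finset.sum_sigma']
  refine Finset.sum_nbij' (fun q => ⟨insert q.2.2 (q.1.erase q.2.1), (q.2.2, q.2.1)⟩)
    (fun q => ⟨insert q.2.2 (q.1.erase q.2.1), (q.2.2, q.2.1)⟩) ?_ ?_ ?_ ?_ (fun _ _ => rfl)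
  all_goals
    rintro ⟨U, i, j⟩ h
    simp only [Finset.mem_sigma, Finset.mem_powersetCard, Finset.mem_product, Finset.mem_compl]
      at h ⊢
    have key := swap_eq_iff.1 ⟨h.2.1, h.2.2, rfl⟩
  · refine ⟨⟨Finset.subset_univ _, ?_⟩, key.1, key.2.1⟩
    rw [Finset.card_insert_of_notMem (fun h' => h.2.2 (Finset.mem_of_mem_erase h')),
      Finset.card_erase_add_one h.2.1, h.1.2]
  · refine ⟨⟨Finset.subset_univ _, ?_⟩, key.1, key.2.1⟩
    rw [Finset.card_insert_of_notMem (fun h' => h.2.2 (Finset.mem_of_mem_erase h')),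
      Finset.card_erase_add_one h.2.1, h.1.2]
  · rw [key.2.2]
  · rw [key.2.2]

theorem bufferStep_dist {s : ℕ} (hs : s ≠ 0) (hsn : s < n) {U U₀ : Finset (Fin n)}
    (hU₀ : U₀.card = s) (hU : U.card = s) {f : ℕ → ℝ}
    (hf : ∀ d, d ≤ s → d ≤ n - s → 0 ≤ f d) :
    bufferStep (fun V => if V.card = s then ENNReal.ofReal (f (V \ U₀).card) else 0) U =
      ENNReal.ofReal (((s : ℝ) * (n - s : ℝ))⁻¹ * urnStep s (n - s : ℝ) f (U \ U₀).card) := by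
  have hc : ((Uᶜ.card : ℕ) : ℝ) = n - s := by
    have h2 := Finset.card_add_card_compl U
    rw [Fintype.card_fin, hU] at h2
    have h3 := congrArg (Nat.cast (R := ℝ)) h2
    push_cast at h3
    linarith
  have hs0 : (0 : ℝ) < s := by exact_mod_cast Nat.pos_of_ne_zero hs
  have hm0 : (0 : ℝ) < n - s := by
    have : (s : ℝ) < n := by exact_mod_cast hsn
    linarith
  have hsw : ∀ i ∈ U, ∀ j ∈ Uᶜ, (insert j (U.erase i)).card = s := by
    intro i hi j hj
    rw [Finset.card_insert_of_notMem
      (fun h' => Finset.mem_compl.1 hj (Finset.mem_of_mem_erase h')),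
      Finset.card_erase_add_one hi, hU]
  have hpos : ∀ i ∈ U, ∀ j ∈ Uᶜ, 0 ≤ f (insert j (U.erase i) \ U₀).card := by
    intro i hi j hj
    refine hf _ ?_ ?_
    · rw [← hsw i hi j hj]
      exact Finset.card_le_card Finset.sdiff_subset
    · rw [← hU₀]
      exact card_sdiff_le_card_compl _ _
  have hsum : ∑ i ∈ U, ∑ j ∈ Uᶜ, (if (insert j (U.erase i)).card = s then
      ENNReal.ofReal (f (insert j (U.erase i) \ U₀).card) else 0) =
      ENNReal.ofReal (urnStep s (n - s : ℝ) f (U \ U₀).card) := by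
    have h := sum_swap_sdiff (hU.trans hU₀.symm) f
    rw [hU₀] at h
    rw [← h, ENNReal.ofReal_sum_of_nonneg fun i hi => Finset.sum_nonneg fun j hj => hpos i hi j hj]
    refine Finset.sum_congr rfl fun i hi => ?_
    rw [ENNReal.ofReal_sum_of_nonneg fun j hj => hpos i hi j hj]
    exact Finset.sum_congr rfl fun j hj => if_pos (hsw i hi j hj)
  rw [bufferStep, hsum, ENNReal.ofReal_mul (by positivity), mul_inv,
    ENNReal.ofReal_mul (by positivity), ENNReal.ofReal_inv_of_pos hs0,
    ENNReal.ofReal_inv_of_pos hm0, ← hc, ENNReal.ofReal_natCast, ENNReal.ofReal_natCast, hU]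

/-! ### Strong stationary duality -/

/-- A finite family of densities `E`, among which one round of the chain of buffers moves according
to the kernel `K`, with rate `φ` of entering the uniform density, gives rise to a rule for marking
buffers as mixed. The potential `f` bounds the expected number of rounds that this takes. -/
theorem exists_bufferFlow_of_dual {ι : Type*} [Fintype ι] {s : ℕ} (hs : s ≠ 0) (hsn : s < n)
    (U₀ : Finset (Fin n)) (hU₀ : U₀.card = s) (E : ι → ℕ → ℝ) (K : ι → ι → ℝ) (φ f : ι → ℝ)
    (hE : ∀ x d, 0 ≤ E x d) (hK : ∀ x y, 0 ≤ K x y) (hφ : ∀ x, 0 ≤ φ x) (hf : ∀ x, 0 ≤ f x)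
    (hstep : ∀ x d, d ≤ s → d ≤ n - s → urnStep s (n - s : ℝ) (E x) d =
      (s : ℝ) * (n - s : ℝ) * (∑ y, K x y * E y d + φ x))
    (htot : ∀ x, distTotal U₀ (E x) = 1)
    (hpot : ∀ x, 1 + ∑ y, K x y * f y ≤ f x)
    (x₀ : ι) (hx₀ : ∀ d, d ≤ s → d ≤ n - s → E x₀ d = if d = 0 then 1 else 0) :
    ∃ (a : ℕ → Finset (Fin n) → ℝ≥0∞) (σ : ℕ → ℝ≥0∞),
      (∀ t U, a t U ≠ ∞) ∧ (∀ t, σ t ≠ ∞) ∧ (∀ U, a 0 U = if U = U₀ then 1 else 0) ∧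
      (∀ t U, U.card ≠ s → a t U = 0) ∧
      (∀ t U, U.card = s → bufferStep (a t) U = a (t + 1) U + σ (t + 1)) ∧
      ∑' t, ∑ U, a t U ≤ ENNReal.ofReal (f x₀) := by
  classical
  -- `w t` is the law of the dual chain started at `x₀`, restricted to not yet being absorbed; `g t`
  -- is the resulting mixture of densities.
  let w : ℕ → ι → ℝ := fun t => Nat.rec (fun x => if x = x₀ then 1 else 0)
    (fun _ v y => ∑ x, v x * K x y) t
  have hw0 : ∀ x, w 0 x = if x = x₀ then 1 else 0 := fun _ => rfl
  have hws : ∀ t y, w (t + 1) y = ∑ x, w t x * K x y := fun _ _ => rfl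
  have hwn : ∀ t x, 0 ≤ w t x := by
    intro t
    induction t with
    | zero => intro x; rw [hw0]; split_ifs <;> norm_num
    | succ t ih => intro y; rw [hws]; exact Finset.sum_nonneg fun x _ => mul_nonneg (ih x) (hK x y)
  let g : ℕ → ℕ → ℝ := fun t d => ∑ x, w t x * E x d
  have hgn : ∀ t d, 0 ≤ g t d := fun t d =>
    Finset.sum_nonneg fun x _ => mul_nonneg (hwn t x) (hE x d)
  have hbound : ∀ U : Finset (Fin n), U.card = s →
      (U \ U₀).card ≤ s ∧ (U \ U₀).card ≤ n - s := by
    intro U hU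
    refine ⟨hU ▸ Finset.card_le_card Finset.sdiff_subset, ?_⟩
    rw [← hU₀]; exact card_sdiff_le_card_compl _ _
  have hsm : (0 : ℝ) < s * (n - s : ℝ) := by
    have h1 : (s : ℝ) < n := by exact_mod_cast hsn
    have h2 : (0 : ℝ) < s := by exact_mod_cast Nat.pos_of_ne_zero hs
    exact mul_pos h2 (by linarith)
  have hgstep : ∀ t d, d ≤ s → d ≤ n - s →
      ((s : ℝ) * (n - s : ℝ))⁻¹ * urnStep s (n - s : ℝ) (g t) d =
        g (t + 1) d + ∑ x, w t x * φ x := by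
    intro t d h1 h2
    have e1 : urnStep s (n - s : ℝ) (g t) d = ∑ x, w t x * urnStep s (n - s : ℝ) (E x) d := by
      simp only [urnStep, g, Finset.mul_sum]
      rw [← Finset.sum_add_distrib, ← Finset.sum_add_distrib]
      exact Finset.sum_congr rfl fun x _ => by ring
    have e2 : g (t + 1) d = ∑ x, w t x * ∑ y, K x y * E y d := by
      simp only [g, hws, Finset.sum_mul, Finset.mul_sum]
      rw [Finset.sum_comm]
      exact Finset.sum_congr rfl fun x _ => Finset.sum_congr rfl fun y _ => by ring
    rw [e1, e2, ← Finset.sum_add_distrib, Finset.mul_sum]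
    refine Finset.sum_congr rfl fun x _ => ?_
    rw [hstep x d h1 h2, mul_left_comm, inv_mul_cancel_left₀ hsm.ne', mul_add]
  -- The mass marked at time `t` leaks in the round that starts at `t - 1`; the value of `σ` at 0 is
  -- never used.
  refine ⟨fun t U => if U.card = s then ENNReal.ofReal (g t (U \ U₀).card) else 0,
    fun t => ENNReal.ofReal (∑ x, w (t - 1) x * φ x), ?_, ?_, ?_, ?_, ?_, ?_⟩
  · intro t U
    dsimp only
    split_ifs
    · exact ENNReal.ofReal_ne_top
    · exact ENNReal.zero_ne_top
  · exact fun t => ENNReal.ofReal_ne_top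
  · intro U
    dsimp only
    by_cases hU : U.card = s
    · rw [if_pos hU]
      have h1 : g 0 (U \ U₀).card = E x₀ (U \ U₀).card := by
        simp [g, hw0]
      rw [h1, hx₀ _ (hbound U hU).1 (hbound U hU).2]
      have h2 : (U \ U₀).card = 0 ↔ U = U₀ := by
        rw [Finset.card_eq_zero, Finset.sdiff_eq_empty_iff_subset]
        exact ⟨fun h => Finset.eq_of_subset_of_card_le h (by omega), fun h => h ▸ subset_rfl⟩
      simp only [h2]
      split_ifs <;> simp
    · rw [if_neg hU, if_neg]
      rintro rfl
      exact hU hU₀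
  · intro t U hU
    exact if_neg hU
  · intro t U hU
    rw [bufferStep_dist hs hsn hU₀ hU fun d _ _ => hgn t d,
      hgstep t _ (hbound U hU).1 (hbound U hU).2]
    have hsg : 0 ≤ ∑ x, w t x * φ x :=
      Finset.sum_nonneg fun x _ => mul_nonneg (hwn t x) (hφ x)
    refine (ENNReal.ofReal_add (hgn (t + 1) _) hsg).trans ?_
    exact congrArg (· + _) (if_pos hU).symm
  · have hmass : ∀ t, ∑ U : Finset (Fin n),
        (if U.card = s then ENNReal.ofReal (g t (U \ U₀).card) else 0) =
        ENNReal.ofReal (∑ x, w t x) := by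
      intro t
      have h1 : ∑ x, w t x = distTotal U₀ (g t) := by
        have h2 : g t = ∑ x, w t x • E x := by
          ext d; simp [g, Finset.sum_apply]
        rw [h2, map_sum]
        simp [htot]
      rw [h1, distTotal_apply, hU₀, ENNReal.ofReal_sum_of_nonneg fun U _ => hgn _ _,
        ← Finset.sum_filter]
      refine Finset.sum_congr ?_ fun _ _ => rfl
      ext U; simp [Finset.mem_powersetCard]
    simp_rw [hmass]
    refine ENNReal.tsum_le_of_sum_range_le fun t => ?_
    rw [← ENNReal.ofReal_sum_of_nonneg fun i _ => Finset.sum_nonneg fun x _ => hwn i x]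
    refine ENNReal.ofReal_le_ofReal ?_
    -- Elapsed survival time plus the remaining potential is a supermartingale in expectation.
    have htele : ∑ i ∈ Finset.range t, ∑ x, w i x + ∑ x, w t x * f x ≤ f x₀ := by
      induction t with
      | zero => simp [hw0]
      | succ t ih =>
        refine le_trans ?_ ih
        rw [Finset.sum_range_succ, add_assoc]
        gcongr
        have e : ∑ y, w (t + 1) y * f y = ∑ x, w t x * ∑ y, K x y * f y := by
          simp only [hws, Finset.sum_mul, Finset.mul_sum]
          rw [Finset.sum_comm]
          exact Finset.sum_congr rfl fun x _ => Finset.sum_congr rfl fun y _ => by ring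
        rw [e, ← Finset.sum_add_distrib]
        refine Finset.sum_le_sum fun x _ => ?_
        have := mul_le_mul_of_nonneg_left (hpot x) (hwn t x)
        linarith
    have hnn : 0 ≤ ∑ x, w t x * f x := Finset.sum_nonneg fun x _ => mul_nonneg (hwn t x) (hf x)
    linarith


/-! ### The explicit dual densities -/

theorem mul_choose_pred_left (e l : ℕ) :
    (e : ℝ) * ((e - 1).choose l : ℝ) = (e - l) * (e.choose l : ℝ) := by
  cases e with
  | zero => cases l <;> simp
  | succ e =>
    have h := Nat.choose_mul_succ_eq e l
    rw [Nat.add_sub_cancel]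
    rcases le_or_gt l (e + 1) with hl | hl
    · have h2 := congrArg (Nat.cast (R := ℝ)) h
      push_cast [Nat.cast_sub hl] at h2 ⊢
      linarith
    · rw [Nat.choose_eq_zero_of_lt hl, Nat.choose_eq_zero_of_lt (by omega)]
      simp

theorem mul_choose_succ_right (e l : ℕ) :
    ((l : ℝ) + 1) * (e.choose (l + 1) : ℝ) = (e - l) * (e.choose l : ℝ) := by
  have h := Nat.choose_succ_right_eq e l
  rcases le_or_gt l e with hl | hl
  · have h2 := congrArg (Nat.cast (R := ℝ)) h
    push_cast [Nat.cast_sub hl] at h2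
    linarith
  · rw [Nat.choose_eq_zero_of_lt hl, Nat.choose_eq_zero_of_lt (by omega)]
    simp

/-- Up to a constant, the density of a uniform buffer among those inside the union of the initial
buffer and a random set of `k` of the `M` other blocks, as a function of the number of blocks by
which it differs from the initial buffer. -/
def insideDensity (M k d : ℕ) : ℝ := ((M - d).choose (M - k) : ℝ)

/-- Up to a constant, the density of a buffer with one random block outside, and otherwise uniform
inside, the union of the initial buffer and a random set of `k` of the `M` other blocks. -/
def freshDensity (M k d : ℕ) : ℝ := d * ((M - d).choose (M - 1 - k) : ℝ)

theorem insideDensity_nonneg (M k d : ℕ) : 0 ≤ insideDensity M k d := Nat.cast_nonneg _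

theorem freshDensity_nonneg (M k d : ℕ) : 0 ≤ freshDensity M k d :=
  mul_nonneg (Nat.cast_nonneg _) (Nat.cast_nonneg _)

theorem sq_mul_choose_pred (M d q : ℕ) (hd : d ≤ M) (x : ℕ → ℝ) :
    (d : ℝ) ^ 2 * (x (d - 1) * ((M - (d - 1)).choose q : ℝ)) =
      (d : ℝ) ^ 2 * (x (d - 1) * ((M - d + 1).choose q : ℝ)) := by
  rcases Nat.eq_zero_or_pos d with rfl | h
  · simp
  · rw [show M - (d - 1) = M - d + 1 by omega]

/-- From inside a union of size `S + k`, the admitted block stays inside in `k` of the `M` cases and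
is otherwise the one outsider. Algebraically, Pascal's rule and the two absorption identities
suffice. -/
theorem urnStep_insideDensity (S : ℝ) {M k d : ℕ} (hk : k < M) (hd : d ≤ M) :
    urnStep S M (insideDensity M k) d =
      S * k * insideDensity M k d + (k + 1) * freshDensity M k d := by
  obtain ⟨q, rfl⟩ : ∃ q, M = k + (q + 1) := ⟨M - k - 1, by omega⟩
  obtain ⟨e, he⟩ : ∃ e, k + (q + 1) = d + e := ⟨_, (Nat.add_sub_cancel' hd).symm⟩
  have h1 := sq_mul_choose_pred (k + (q + 1)) d (q + 1) hd fun _ => 1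
  simp only [one_mul] at h1
  simp only [urnStep, insideDensity, freshDensity, show k + (q + 1) - k = q + 1 by omega,
    show k + (q + 1) - 1 - k = q by omega, h1, show k + (q + 1) - d = e by omega,
    show k + (q + 1) - (d + 1) = e - 1 by omega, Nat.choose_succ_succ' e q]
  have hM : ((k + (q + 1) : ℕ) : ℝ) = d + e := by rw [he]; push_cast; ring
  have hk' : (k : ℝ) = d + e - q - 1 := by push_cast at hM; linarith
  have h2 := mul_choose_pred_left e (q + 1)
  have h3 := mul_choose_succ_right e q
  rw [hM, hk']
  push_cast at h2 ⊢
  linear_combination (S - d) * h2 + (d : ℝ) * h3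

/-- The inside term comes from evicting the outsider and admitting a block of the union; the
remaining moves recombine into fresh densities of levels `k + 1` and `k`. The last coefficient is
nonnegative for every `k` only if `M ≤ S`. -/
theorem urnStep_freshDensity (S : ℝ) {M k d : ℕ} (hk : k + 1 < M) (hd : d ≤ M) :
    urnStep S M (freshDensity M k) d =
      S * (M - k) * insideDensity M k d + (k + 1) * (k + 2) * freshDensity M (k + 1) d +
        (k + 1) * (S - M + k) * freshDensity M k d := by
  obtain ⟨r, rfl⟩ : ∃ r, M = k + (r + 2) := ⟨M - k - 2, by omega⟩
  obtain ⟨e, he⟩ : ∃ e, k + (r + 2) = d + e := ⟨_, (Nat.add_sub_cancel' hd).symm⟩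
  have h1 := sq_mul_choose_pred (k + (r + 2)) d (r + 1) hd fun i => i
  have hM : ((k + (r + 2) : ℕ) : ℝ) = d + e := by rw [he]; push_cast; ring
  have hk' : (k : ℝ) = d + e - r - 2 := by push_cast at hM; linarith
  have h4 : (d : ℝ) ^ 2 * ((d - 1 : ℕ) : ℝ) = (d : ℝ) ^ 2 * (d - 1) := by
    cases d <;> simp
  simp only [urnStep, insideDensity, freshDensity, show k + (r + 2) - k = r + 2 by omega,
    show k + (r + 2) - 1 - k = r + 1 by omega, show k + (r + 2) - 1 - (k + 1) = r by omega,
    h1, show k + (r + 2) - d = e by omega,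
    show k + (r + 2) - (d + 1) = e - 1 by omega, Nat.choose_succ_succ' e r]
  rw [← mul_assoc ((d : ℝ) ^ 2), h4]
  have h2 := mul_choose_pred_left e (r + 1)
  have h3 := mul_choose_succ_right e r
  have h5 := mul_choose_succ_right e (r + 1)
  rw [hM, hk']
  push_cast at h2 h5 ⊢
  linear_combination (S - d) * (d + 1) * h2 - S * h5 + (d : ℝ) * (e + 2 * d - 1 - r) * h3

/-- At the top level the density is just `d`, and the constant `S * M` is the leak into the uniform
density. -/
theorem urnStep_freshDensity_last (S : ℝ) {M d : ℕ} :
    urnStep S M (freshDensity M (M - 1)) d =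
      S * M + (S * M - S - M) * freshDensity M (M - 1) d := by
  have h4 : (d : ℝ) ^ 2 * ((d - 1 : ℕ) : ℝ) = (d : ℝ) ^ 2 * (d - 1) := by
    cases d <;> simp
  simp only [urnStep, freshDensity, Nat.sub_self, Nat.choose_zero_right, Nat.cast_one, mul_one,
    h4]
  push_cast
  ring


/-! ### Normalizing constants -/

section Totals

variable {S M : ℕ} {τ : (ℕ → ℝ) →ₗ[ℝ] ℝ}

theorem total_insideDensity_zero
    (hcongr : ∀ f g : ℕ → ℝ, (∀ d, d ≤ M → f d = g d) → τ f = τ g)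
    (h0 : τ (fun d => if d = 0 then 1 else 0) = 1) : τ (insideDensity M 0) = 1 := by
  rw [← h0]
  refine hcongr _ _ fun d hd => ?_
  rw [insideDensity, Nat.sub_zero]
  split_ifs with h
  · simp [h]
  · rw [Nat.choose_eq_zero_of_lt (by omega), Nat.cast_zero]

theorem total_insideDensity_eq
    (hcongr : ∀ f g : ℕ → ℝ, (∀ d, d ≤ M → f d = g d) → τ f = τ g)
    (hstep : ∀ f, τ (urnStep S M f) = S * M * τ f) {k : ℕ} (hk : k < M) :
    (S : ℝ) * (M - k) * τ (insideDensity M k) = (k + 1) * τ (freshDensity M k) := by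
  have h := hstep (insideDensity M k)
  rw [hcongr _ ((S * k : ℝ) • insideDensity M k + (k + 1 : ℝ) • freshDensity M k)
    fun d hd => urnStep_insideDensity S hk hd, map_add, map_smul, map_smul, smul_eq_mul,
    smul_eq_mul] at h
  linarith

theorem total_freshDensity_succ
    (hcongr : ∀ f g : ℕ → ℝ, (∀ d, d ≤ M → f d = g d) → τ f = τ g)
    (hstep : ∀ f, τ (urnStep S M f) = S * M * τ f) {k : ℕ} (hk : k + 1 < M) :
    ((k : ℝ) + 1) * (k + 2) * τ (freshDensity M (k + 1)) =
      (M - k - 1) * (S + k + 1) * τ (freshDensity M k) := by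
  have h := hstep (freshDensity M k)
  rw [hcongr _ ((S * (M - k) : ℝ) • insideDensity M k +
      ((k + 1) * (k + 2) : ℝ) • freshDensity M (k + 1) +
      ((k + 1) * (S - M + k) : ℝ) • freshDensity M k)
    fun d hd => urnStep_freshDensity S hk hd, map_add, map_add, map_smul, map_smul, map_smul,
    smul_eq_mul, smul_eq_mul, smul_eq_mul,
    total_insideDensity_eq hcongr hstep (Nat.lt_of_succ_lt hk)] at h
  linarith

/-- Totals of inside and fresh densities at the same level are positively proportional, as are
consecutive fresh totals, and the chain starts at total 1. -/
theorem total_pos (hS : 0 < S)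
    (hcongr : ∀ f g : ℕ → ℝ, (∀ d, d ≤ M → f d = g d) → τ f = τ g)
    (hstep : ∀ f, τ (urnStep S M f) = S * M * τ f)
    (h0 : τ (fun d => if d = 0 then 1 else 0) = 1) {k : ℕ} (hk : k < M) :
    0 < τ (insideDensity M k) ∧ 0 < τ (freshDensity M k) := by
  have hS' : (0 : ℝ) < S := by exact_mod_cast hS
  have hMk : ∀ k : ℕ, k < M → (0 : ℝ) < M - k := fun k hk => by
    have : (k : ℝ) < M := by exact_mod_cast hk
    linarith
  have hiff : ∀ k : ℕ, k < M →
      (0 < τ (insideDensity M k) ↔ 0 < τ (freshDensity M k)) := by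
    intro k hk
    have h := total_insideDensity_eq hcongr hstep hk
    have h1 : 0 < (S : ℝ) * (M - k) := mul_pos hS' (hMk k hk)
    have h2 : (0 : ℝ) < k + 1 := by positivity
    rw [← mul_pos_iff_of_pos_left h1, h, mul_pos_iff_of_pos_left h2]
  have hfresh : 0 < τ (freshDensity M k) := by
    induction k with
    | zero =>
      rw [← hiff 0 hk, total_insideDensity_zero hcongr h0]
      exact one_pos
    | succ k ih =>
      have h := total_freshDensity_succ hcongr hstep hk
      have h1 : (0 : ℝ) < (k + 1) * (k + 2) := by positivity
      rw [← mul_pos_iff_of_pos_left h1, h]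
      have h2 := hMk (k + 1) hk
      push_cast at h2
      have := ih (by omega)
      refine mul_pos (mul_pos (by linarith) (by positivity)) this
  exact ⟨(hiff k hk).2 hfresh, hfresh⟩

end Totals

/-! ### The dual chain and its absorption time -/

/-- The harmonic sum `1 + 1 / 2 + ⋯ + 1 / j`. -/
noncomputable def harmonicSum (j : ℕ) : ℝ := ∑ i ∈ Finset.range j, ((i : ℝ) + 1)⁻¹

theorem harmonicSum_nonneg (j : ℕ) : 0 ≤ harmonicSum j :=
  Finset.sum_nonneg fun i _ => by positivity

/-- The generator is symmetric in the two urn sizes, so `S` and `M` may be taken as the larger and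
the smaller of `s` and `n - s`. This meets the condition `M ≤ S` that the dual kernel needs. -/
theorem exists_bufferFlow {s S M : ℕ} (hs : s ≠ 0) (hsn : s < n) (hM : 2 ≤ M) (hMS : M ≤ S)
    (hurn : urnStep s (n - s : ℝ) = urnStep S M) (hmul : (s : ℝ) * (n - s : ℝ) = S * M)
    (hle : ∀ d, d ≤ s → d ≤ n - s → d ≤ M)
    (U₀ : Finset (Fin n)) (hU₀ : U₀.card = s) :
    ∃ (a : ℕ → Finset (Fin n) → ℝ≥0∞) (σ : ℕ → ℝ≥0∞),
      (∀ t U, a t U ≠ ∞) ∧ (∀ t, σ t ≠ ∞) ∧ (∀ U, a 0 U = if U = U₀ then 1 else 0) ∧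
      (∀ t U, U.card ≠ s → a t U = 0) ∧
      (∀ t U, U.card = s → bufferStep (a t) U = a (t + 1) U + σ (t + 1)) ∧
      ∑' t, ∑ U, a t U ≤ ENNReal.ofReal (1 + M + M * harmonicSum (M - 1)) := by
  classical
  set τ := distTotal U₀ with hτ
  have hcongr : ∀ f g : ℕ → ℝ, (∀ d, d ≤ M → f d = g d) → τ f = τ g := fun f g h =>
    distTotal_congr U₀ fun d h1 h2 => h d (hle d (hU₀ ▸ h1) (hU₀ ▸ h2))
  have hstep : ∀ f, τ (urnStep S M f) = S * M * τ f := by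
    intro f
    rw [← hurn, ← hmul, ← hU₀]
    exact distTotal_urnStep U₀ f
  have h0 : τ (fun d => if d = 0 then 1 else 0) = 1 := distTotal_indicator U₀
  have hSpos : 0 < S := by omega
  have hpos : ∀ k : Fin M, 0 < τ (insideDensity M k) ∧ 0 < τ (freshDensity M k) :=
    fun k => total_pos hSpos hcongr hstep h0 k.2
  have hMr : (2 : ℝ) ≤ M := by exact_mod_cast hM
  have hSr : (M : ℝ) ≤ S := by exact_mod_cast hMS
  have hSM : (0 : ℝ) < S * M := by positivity
  have hkM : ∀ k : Fin M, (k : ℝ) + 1 ≤ M := fun k => by exact_mod_cast k.2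
  -- States `(k, false)` are the inside densities and `(k, true)` the fresh ones, normalized to
  -- total 1; `K` holds the coefficients of the one-round identities after this normalization.
  let E : Fin M × Bool → ℕ → ℝ := fun x => match x with
    | (k, false) => fun d => (τ (insideDensity M k))⁻¹ * insideDensity M k d
    | (k, true) => fun d => (τ (freshDensity M k))⁻¹ * freshDensity M k d
  let K : Fin M × Bool → Fin M × Bool → ℝ := fun x => match x with
    | (k, false) => Pi.single (k, false) ((k : ℝ) / M) + Pi.single (k, true) ((M - k : ℝ) / M)
    | (k, true) =>
      if h : k.1 + 1 < M then
        Pi.single (k, false) ((k + 1 : ℝ) / (S * M)) +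
          Pi.single (⟨k.1 + 1, h⟩, true) ((M - k - 1) * (S + k + 1 : ℝ) / (S * M)) +
          Pi.single (k, true) ((k + 1) * (S - M + k : ℝ) / (S * M))
      else Pi.single (k, true) ((S * M - S - M : ℝ) / (S * M))
  let φ : Fin M × Bool → ℝ := fun x => match x with
    | (_, false) => 0
    | (k, true) => if k.1 + 1 < M then 0 else (τ (freshDensity M k))⁻¹
  -- An inside state is left with probability `(M - k) / M`, in mean time `M / (M - k)`. A fresh
  -- state advances with probability at least `(M - k - 1) / M`; these waits add up to the harmonic
  -- sum, and the remaining `M` is for absorption from the top.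
  let f : Fin M × Bool → ℝ := fun x => match x with
    | (k, false) => M / (M - k : ℝ) + (M + M * harmonicSum (M - 1 - k))
    | (k, true) => M + M * harmonicSum (M - 1 - k)
  have hsingle : ∀ (x : Fin M × Bool) (c : ℝ) (g : Fin M × Bool → ℝ),
      ∑ y, (Pi.single x c : Fin M × Bool → ℝ) y * g y = c * g x := by
    intro x c g
    rw [Finset.sum_eq_single x]
    · rw [Pi.single_eq_same]
    · intro y _ hy; rw [Pi.single_eq_of_ne hy, zero_mul]
    · intro h; exact absurd (Finset.mem_univ x) h
  have hK0 : ∀ (k : Fin M) (g : Fin M × Bool → ℝ), ∑ y, K (k, false) y * g y =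
      (k : ℝ) / M * g (k, false) + (M - k : ℝ) / M * g (k, true) := by
    intro k g
    simp only [K, Pi.add_apply, add_mul, Finset.sum_add_distrib, hsingle]
  have hK1 : ∀ (k : Fin M) (h : k.1 + 1 < M) (g : Fin M × Bool → ℝ), ∑ y, K (k, true) y * g y =
      (k + 1 : ℝ) / (S * M) * g (k, false) +
        (M - k - 1) * (S + k + 1 : ℝ) / (S * M) * g (⟨k.1 + 1, h⟩, true) +
        (k + 1) * (S - M + k : ℝ) / (S * M) * g (k, true) := by
    intro k h g
    simp only [K, dif_pos h, Pi.add_apply, add_mul, Finset.sum_add_distrib, hsingle]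
  have hK2 : ∀ (k : Fin M) (_ : ¬ k.1 + 1 < M) (g : Fin M × Bool → ℝ),
      ∑ y, K (k, true) y * g y = (S * M - S - M : ℝ) / (S * M) * g (k, true) := by
    intro k h g
    simp only [K, dif_neg h, hsingle]
  -- This is `(S - 1) * (M - 1) ≥ 1`, which fails for `M = 1`.
  have hlast : (0 : ℝ) ≤ S * M - S - M := by nlinarith
  have hsn0 : ∀ (x y : Fin M × Bool) (c : ℝ), 0 ≤ c →
      0 ≤ (Pi.single x c : Fin M × Bool → ℝ) y := by
    intro x y c hc
    rw [Pi.single_apply]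
    split_ifs
    · exact hc
    · exact le_rfl
  have hfpos : ∀ k : Fin M, (0 : ℝ) ≤ M + M * harmonicSum (M - 1 - k) := fun k => by
    have := harmonicSum_nonneg (M - 1 - k)
    positivity
  obtain ⟨a, σ, h1, h2, h3, h4, h5, h6⟩ := exists_bufferFlow_of_dual hs hsn U₀ hU₀ E K φ f
    (by
      rintro ⟨k, _ | _⟩ d
      · exact mul_nonneg (inv_nonneg.2 (hpos k).1.le) (insideDensity_nonneg _ _ _)
      · exact mul_nonneg (inv_nonneg.2 (hpos k).2.le) (freshDensity_nonneg _ _ _))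
    (by
      rintro ⟨k, _ | _⟩ y
      · have := hkM k
        exact add_nonneg (hsn0 _ _ _ (by positivity))
          (hsn0 _ _ _ (div_nonneg (by linarith) (by positivity)))
      · have := hkM k
        simp only [K]
        split_ifs
        · refine add_nonneg (add_nonneg (hsn0 _ _ _ (by positivity)) (hsn0 _ _ _ ?_))
            (hsn0 _ _ _ ?_)
          · exact div_nonneg (mul_nonneg (by linarith) (by positivity)) hSM.le
          · exact div_nonneg (mul_nonneg (by positivity) (by
              have : (0 : ℝ) ≤ k := Nat.cast_nonneg _
              linarith)) hSM.le
        · exact hsn0 _ _ _ (div_nonneg hlast hSM.le))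
    (by
      rintro ⟨k, _ | _⟩
      · exact le_rfl
      · simp only [φ]
        split_ifs
        · exact le_rfl
        · exact inv_nonneg.2 (hpos k).2.le)
    (by
      rintro ⟨k, _ | _⟩
      · have := hkM k
        exact add_nonneg (div_nonneg (by positivity) (by linarith)) (hfpos k)
      · exact hfpos k)
    (by
      have hsmul : ∀ (c : ℝ) (g : ℕ → ℝ) (d : ℕ),
          urnStep S M (fun d => c * g d) d = c * urnStep S M g d := by
        intro c g d; simp only [urnStep]; ring
      rintro ⟨k, _ | _⟩ d hd1 hd2
      · have hdM := hle d hd1 hd2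
        rw [hurn, hmul, hK0]
        simp only [E, φ, hsmul, urnStep_insideDensity (S : ℝ) k.2 hdM]
        have hb := (hpos k).1.ne'
        have hc := (hpos k).2.ne'
        have h := total_insideDensity_eq hcongr hstep k.2
        field_simp
        linear_combination -(freshDensity M k d) * h
      · have hdM := hle d hd1 hd2
        have hb := (hpos k).1.ne'
        have hc := (hpos k).2.ne'
        rw [hurn, hmul]
        by_cases hk : k.1 + 1 < M
        · rw [hK1 k hk]
          simp only [E, φ, hsmul, urnStep_freshDensity (S : ℝ) hk hdM, if_pos hk]
          have hc' := (hpos ⟨k.1 + 1, hk⟩).2.ne'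
          have h := total_insideDensity_eq hcongr hstep k.2
          have h' := total_freshDensity_succ hcongr hstep hk
          simp only at hc'
          have e1 : (τ (freshDensity M k))⁻¹ * (S * (M - k)) =
              (k + 1) * (τ (insideDensity M k))⁻¹ := by
            field_simp
            linear_combination h
          have e2 : (τ (freshDensity M k))⁻¹ * ((k + 1) * (k + 2)) =
              (M - k - 1) * (S + k + 1) * (τ (freshDensity M (k + 1)))⁻¹ := by
            field_simp
            linear_combination h'
          have e3 : ∀ x : ℝ, (S * M : ℝ) * (x / (S * M)) = x := fun x =>
            mul_div_cancel₀ x hSM.ne'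
          rw [add_zero, mul_add (S * M : ℝ), mul_add (S * M : ℝ), ← mul_assoc (S * M : ℝ), ← mul_assoc (S * M : ℝ),
            ← mul_assoc (S * M : ℝ), e3, e3, e3]
          linear_combination insideDensity M k d * e1 + freshDensity M (k + 1) d * e2
        · rw [hK2 k hk]
          have hk' : (k : ℕ) = M - 1 := by have := k.2; omega
          simp only [E, φ, hsmul, if_neg hk]
          have hstepl := urnStep_freshDensity_last (S : ℝ) (M := M) (d := d)
          rw [← hk'] at hstepl
          rw [hstepl]
          field_simp
          ring)
    (by
      rintro ⟨k, _ | _⟩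
      · have e : E (k, false) = (τ (insideDensity M k))⁻¹ • insideDensity M k := rfl
        rw [← hτ, e, map_smul, smul_eq_mul, inv_mul_cancel₀ (hpos k).1.ne']
      · have e : E (k, true) = (τ (freshDensity M k))⁻¹ • freshDensity M k := rfl
        rw [← hτ, e, map_smul, smul_eq_mul, inv_mul_cancel₀ (hpos k).2.ne'])
    (by
      rintro ⟨k, _ | _⟩
      · rw [hK0]
        simp only [f]
        have := hkM k
        have h : (M - k : ℝ) ≠ 0 := by linarith
        refine le_of_eq ?_
        field_simp
        ring
      · by_cases hk : k.1 + 1 < M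
        · rw [hK1 k hk]
          simp only [f]
          have hj : harmonicSum (M - 1 - k) =
              harmonicSum (M - 1 - (k + 1)) + (M - k - 1 : ℝ)⁻¹ := by
            rw [show M - 1 - (k : ℕ) = M - 1 - (k + 1) + 1 by omega, harmonicSum,
              Finset.sum_range_succ, ← harmonicSum]
            congr 2
            rw [Nat.cast_sub (by omega), Nat.cast_sub (by omega)]
            push_cast
            ring
          rw [hj]
          have hk2 : (k : ℝ) + 2 ≤ M := by exact_mod_cast hk
          have hk0 : (0 : ℝ) ≤ k := Nat.cast_nonneg _
          set H := harmonicSum (M - 1 - (k + 1))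
          set kk : ℝ := ((k : ℕ) : ℝ)
          have p1 : (0 : ℝ) < M - kk := by linarith
          have p2 : (0 : ℝ) < M - kk - 1 := by linarith
          have p3 : (0 : ℝ) < S := by linarith
          -- The cost of falling back to the inside state is outweighed by the factor `(S + k + 1) /
          -- S` in the advance probability.
          have key : (kk + 1) / (S * (M - kk)) ≤ (kk + 1) / S := by
            gcongr
            exact le_mul_of_one_le_right p3.le (by linarith)
          have e : 1 + ((kk + 1) / (S * M) * (M / (M - kk) + (M + M * (H + (M - kk - 1)⁻¹))) +
              (M - kk - 1) * (S + kk + 1) / (S * M) * (M + M * H) +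
              (kk + 1) * (S - M + kk) / (S * M) * (M + M * (H + (M - kk - 1)⁻¹))) =
              (M + M * (H + (M - kk - 1)⁻¹)) + ((kk + 1) / (S * (M - kk)) - (kk + 1) / S) := by
            field_simp
            ring
          rw [e]
          linarith
        · rw [hK2 k hk]
          have hk' : (k : ℕ) = M - 1 := by have := k.2; omega
          simp only [f, hk', Nat.sub_self, harmonicSum, Finset.sum_range_zero, mul_zero, add_zero]
          have p3 : (0 : ℝ) < S := by linarith
          have e : 1 + (S * M - S - M : ℝ) / (S * M) * M = M - M / S := by
            field_simp
            ring
          rw [e]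
          have : (0 : ℝ) ≤ M / S := by positivity
          linarith)
    (⟨0, by omega⟩, false)
    (by
      intro d hd1 hd2
      have hdM := hle d hd1 hd2
      have hb : τ (insideDensity M 0) = 1 := total_insideDensity_zero hcongr h0
      simp only [E, hb, inv_one, one_mul, insideDensity, Nat.sub_zero]
      split_ifs with h
      · simp [h]
      · rw [Nat.choose_eq_zero_of_lt (by omega), Nat.cast_zero])
  refine ⟨a, σ, h1, h2, h3, h4, h5, h6.trans (ENNReal.ofReal_le_ofReal (le_of_eq ?_))⟩
  simp only [f, Nat.cast_zero, sub_zero, Nat.sub_zero]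
  rw [div_self (by positivity)]
  ring

/-- With a single block outside, the first round always leaves the initial buffer and makes the
buffer uniform among the others. From there a round returns to the initial buffer with weight `1 / s
^ 2` and otherwise lands in the uniform density. The potentials 3 and 2 work because `1 + 3 / s ^ 2
≤ 2`. -/
theorem exists_bufferFlow_of_compl_singleton {s : ℕ} (hs : 2 ≤ s) (hsn : n = s + 1)
    (U₀ : Finset (Fin n)) (hU₀ : U₀.card = s) :
    ∃ (a : ℕ → Finset (Fin n) → ℝ≥0∞) (σ : ℕ → ℝ≥0∞),
      (∀ t U, a t U ≠ ∞) ∧ (∀ t, σ t ≠ ∞) ∧ (∀ U, a 0 U = if U = U₀ then 1 else 0) ∧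
      (∀ t U, U.card ≠ s → a t U = 0) ∧
      (∀ t U, U.card = s → bufferStep (a t) U = a (t + 1) U + σ (t + 1)) ∧
      ∑' t, ∑ U, a t U ≤ ENNReal.ofReal 3 := by
  have hsr : (2 : ℝ) ≤ s := by exact_mod_cast hs
  have hs0 : (s : ℝ) ≠ 0 := by linarith
  have hns : (n : ℝ) - s = 1 := by rw [hsn]; push_cast; ring
  have htot := distTotal_urnStep U₀ (fun d => if d = 0 then 1 else 0)
  have hcongr : ∀ f g : ℕ → ℝ, f 0 = g 0 → f 1 = g 1 → distTotal U₀ f = distTotal U₀ g := by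
    intro f g h0 h1
    refine distTotal_congr U₀ fun d _ hd => ?_
    have : d ≤ 1 := by omega
    interval_cases d
    · exact h0
    · exact h1
  have hfresh : distTotal U₀ (fun d => (d : ℝ) / s) = 1 := by
    rw [distTotal_indicator, hU₀, hns] at htot
    rw [hcongr _ ((s : ℝ) • fun d : ℕ => (d : ℝ) / s) (by simp [urnStep])
      (by simp [urnStep]; field_simp), map_smul, smul_eq_mul] at htot
    exact mul_left_cancel₀ hs0 (by linarith)
  have hsN : s ≠ 0 := by omega
  have hsq : (0 : ℝ) < (s : ℝ) ^ 2 := by positivity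
  obtain ⟨a, σ, h1, h2, h3, h4, h5, h6⟩ := exists_bufferFlow_of_dual (ι := Bool)
    (by omega : s ≠ 0) (by omega) U₀ hU₀
    (fun x d => if x then (d : ℝ) / s else if d = 0 then 1 else 0)
    (fun x y => if x then (if y then 0 else 1 / (s : ℝ) ^ 2) else (if y then 1 else 0))
    (fun x => if x then (s - 1) / (s : ℝ) ^ 2 else 0)
    (fun x => if x then 2 else 3)
    (by rintro (_ | _) d <;> simp <;> positivity)
    (by rintro (_ | _) (_ | _) <;> simp)
    (by rintro (_ | _) <;> simp; exact div_nonneg (by linarith) hsq.le)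
    (by rintro (_ | _) <;> simp)
    (by
      rintro x d - hd
      have hd1 : d ≤ 1 := by omega
      rw [hns]
      rcases x with _ | _ <;> interval_cases d <;> simp [urnStep, hsN] <;> field_simp <;> ring)
    (by
      rintro (_ | _)
      · simpa using distTotal_indicator U₀
      · simpa using hfresh)
    (by
      rintro (_ | _)
      · norm_num
      · simp only [Fintype.sum_bool, if_true]
        have : (1 : ℝ) / (s : ℝ) ^ 2 ≤ 1 / 4 := by
          apply one_div_le_one_div_of_le (by norm_num)
          nlinarith
        norm_num at this ⊢
        linarith)
    false (by intro d _ _; simp)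
  exact ⟨a, σ, h1, h2, h3, h4, h5, by simpa using h6⟩


/-! ### Harmonic sums against binary logarithms -/

theorem inv_le_logb_sub {k : ℕ} (hk : k ≠ 0) :
    (k : ℝ)⁻¹ ≤ Real.logb 2 (k + 1) - Real.logb 2 k := by
  have hk0 : (1 : ℝ) ≤ k := by exact_mod_cast Nat.one_le_iff_ne_zero.2 hk
  rw [← Real.logb_div (by positivity) (by positivity), Real.le_logb_iff_rpow_le (by norm_num)
    (by positivity)]
  -- Bernoulli's inequality for exponents in `[0, 1]`: `2 ^ (1 / k) ≤ 1 + 1 / k`.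
  have h := rpow_one_add_le_one_add_mul_self (s := 1) (p := (k : ℝ)⁻¹) (by norm_num)
    (by positivity) (inv_le_one_of_one_le₀ hk0)
  rw [show ((k : ℝ) + 1) / k = 1 + (k : ℝ)⁻¹ * 1 by field_simp]
  norm_num at h ⊢
  exact h

theorem harmonicSum_le_logb (k : ℕ) : harmonicSum k ≤ Real.logb 2 (k + 1) := by
  induction k with
  | zero => simp [harmonicSum]
  | succ k ih =>
    have h := inv_le_logb_sub k.succ_ne_zero
    rw [harmonicSum, Finset.sum_range_succ, ← harmonicSum]
    push_cast at h ⊢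
    linarith

theorem harmonicSum_pred_le_logb {k : ℕ} (hk : k ≠ 0) :
    harmonicSum (k - 1) ≤ Real.logb 2 k := by
  obtain ⟨j, rfl⟩ := Nat.exists_eq_succ_of_ne_zero hk
  simpa using harmonicSum_le_logb j

theorem couponTime_zero_le {N : ℕ} (hN : N ≠ 0) :
    couponTime N 0 ≤ ENNReal.ofReal (1 + N * Real.logb 2 N) := by
  have h1 : couponTime N 0 = ENNReal.ofReal (N * harmonicSum N) := by
    rw [couponTime, harmonicSum, Nat.sub_zero, ENNReal.ofReal_mul (Nat.cast_nonneg N),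
      ENNReal.ofReal_natCast, ENNReal.ofReal_sum_of_nonneg fun i _ => by positivity]
    congr 1
    refine Finset.sum_congr rfl fun i _ => ?_
    rw [ENNReal.ofReal_inv_of_pos (by positivity)]
    congr 1
    rw [← ENNReal.ofReal_natCast]
    push_cast
    rfl
  rw [h1]
  refine ENNReal.ofReal_le_ofReal ?_
  obtain ⟨j, rfl⟩ := Nat.exists_eq_succ_of_ne_zero hN
  have h2 := harmonicSum_le_logb j
  -- Splitting off the last term `1 / N` gives the additive 1 and leaves a harmonic sum bounded by
  -- `log₂ N`.
  rw [harmonicSum, Finset.sum_range_succ, ← harmonicSum]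
  push_cast
  have hj : (0 : ℝ) < j + 1 := by positivity
  rw [mul_add, mul_inv_cancel₀ hj.ne', add_comm]
  gcongr

theorem mul_logb_mono {a b : ℕ} (ha : a ≠ 0) (hab : a ≤ b) :
    (a : ℝ) * Real.logb 2 a ≤ b * Real.logb 2 b := by
  have ha1 : (1 : ℝ) ≤ a := by exact_mod_cast Nat.one_le_iff_ne_zero.2 ha
  have hab' : (a : ℝ) ≤ b := by exact_mod_cast hab
  have h0 : 0 ≤ Real.logb 2 a := Real.logb_nonneg (by norm_num) ha1
  have h1 : Real.logb 2 a ≤ Real.logb 2 b :=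
    Real.logb_le_logb_of_le (by norm_num) (by linarith) hab'
  exact mul_le_mul hab' h1 h0 (by linarith)

end CAOS

/-! ### Assembling the bound -/

theorem mainTheorem2 (n N s : ℕ) (hs : 2 ≤ s) (hsn : s < n) (hnN : n < N)
    (L₀ : CAOS.Layout n N) (hL₀ : L₀.buffer.card = s) :
    ∃ T : CAOS.StoppingTime n N,
      T.AchievesPerfectPrivacy L₀ ∧
      T.expectedRounds L₀ ≤ ENNReal.ofReal
        (2 + (s : ℝ) + ((n : ℝ) - (s : ℝ)) * Real.logb 2 ((n : ℝ) - (s : ℝ))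
          + (N : ℝ) * Real.logb 2 (N : ℝ)) := by
  obtain ⟨m, rfl⟩ : ∃ m, n = s + m := ⟨n - s, by omega⟩
  have hm0 : m ≠ 0 := by omega
  have hN0 : N ≠ 0 := by omega
  have hcast : (((s + m : ℕ) : ℝ) - s) = m := by push_cast; ring
  have hlm : 0 ≤ (m : ℝ) * Real.logb 2 m := mul_nonneg (Nat.cast_nonneg m)
    (Real.logb_nonneg (by norm_num) (by exact_mod_cast Nat.one_le_iff_ne_zero.2 hm0))
  have hlN : 0 ≤ (N : ℝ) * Real.logb 2 N := mul_nonneg (Nat.cast_nonneg N)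
    (Real.logb_nonneg (by norm_num) (by exact_mod_cast Nat.one_le_iff_ne_zero.2 hN0))
  have hsr : (2 : ℝ) ≤ s := by exact_mod_cast hs
  have hflow : ∃ (a : ℕ → Finset (Fin (s + m)) → ℝ≥0∞) (σ : ℕ → ℝ≥0∞),
      (∀ t U, a t U ≠ ∞) ∧ (∀ t, σ t ≠ ∞) ∧ (∀ U, a 0 U = if U = L₀.buffer then 1 else 0) ∧
      (∀ t U, U.card ≠ s → a t U = 0) ∧
      (∀ t U, U.card = s → CAOS.bufferStep (a t) U = a (t + 1) U + σ (t + 1)) ∧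
      ∑' t, ∑ U, a t U ≤ ENNReal.ofReal (1 + s + m * Real.logb 2 m) := by
    -- Used with `M = min s m`: the linear term is bounded through `M ≤ s`, the logarithmic one
    -- through `M ≤ m`.
    have hbound : ∀ M : ℕ, M ≠ 0 → M ≤ s → M ≤ m →
        (1 + M + M * CAOS.harmonicSum (M - 1) : ℝ) ≤ 1 + s + m * Real.logb 2 m := by
      intro M hM hMs hMm
      have h1 := CAOS.harmonicSum_pred_le_logb hM
      have h2 := CAOS.mul_logb_mono hM hMm
      have h3 : (M : ℝ) ≤ s := by exact_mod_cast hMs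
      have h4 := mul_le_mul_of_nonneg_left h1 (Nat.cast_nonneg (α := ℝ) M)
      linarith
    by_cases hm1 : m = 1
    · subst hm1
      obtain ⟨a, σ, h1, h2, h3, h4, h5, h6⟩ :=
        CAOS.exists_bufferFlow_of_compl_singleton hs rfl L₀.buffer hL₀
      exact ⟨a, σ, h1, h2, h3, h4, h5, h6.trans (ENNReal.ofReal_le_ofReal (by linarith))⟩
    rcases le_total m s with hms | hms
    · obtain ⟨a, σ, h1, h2, h3, h4, h5, h6⟩ := CAOS.exists_bufferFlow (n := s + m) (s := s)
        (S := s) (M := m) (by omega) hsn (by omega) hms (by rw [hcast]) (by rw [hcast])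
        (fun d _ h => by omega) L₀.buffer hL₀
      exact ⟨a, σ, h1, h2, h3, h4, h5,
        h6.trans (ENNReal.ofReal_le_ofReal (hbound m hm0 hms le_rfl))⟩
    · obtain ⟨a, σ, h1, h2, h3, h4, h5, h6⟩ := CAOS.exists_bufferFlow (n := s + m) (s := s)
        (S := m) (M := s) (by omega) hsn hs hms (by rw [hcast, CAOS.urnStep_comm])
        (by rw [hcast, mul_comm]) (fun d h _ => h) L₀.buffer hL₀
      exact ⟨a, σ, h1, h2, h3, h4, h5,
        h6.trans (ENNReal.ofReal_le_ofReal (hbound s (by omega) le_rfl hms))⟩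
  obtain ⟨a, σ, h1, h2, h3, h4, h5, h6⟩ := hflow
  obtain ⟨T, hT, hE⟩ := CAOS.exists_perfectPrivacy_of_bufferFlow hN0 (by omega : s ≠ 0) hsn L₀
    hL₀ a σ h1 h2 h3 h4 h5 (h6.trans_lt ENNReal.ofReal_lt_top).ne
  refine ⟨T, hT, hE.trans ((add_le_add h6 (CAOS.couponTime_zero_le hN0)).trans ?_)⟩
  rw [← ENNReal.ofReal_add (by linarith) (by linarith), hcast]
  exact ENNReal.ofReal_le_ofReal (by linarith)
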